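/- Let $n\ge 1$, $\beta>0$, let scalars be real or complex, and let $\mathcal S,\mathcal S'$ be the Schwartz functions and the tempered distributions on $\mathbb R^n$. Put $u_\lambda=u(\lambda\,\cdot)$, $K_\beta(t,\cdot)=\mathcal F^{-1}(e^{-t|\xi|^\beta})$ (with $\mathcal F^{-1}u(x)=\int e^{2\pi i\langle x,\xi\rangle}u(\xi)\,d\xi$) and $S_\beta(t)u=K_\beta(t,\cdot)*u$, where the convolution is that of an integrable function and a bounded distribution (a $u\in\mathcal S'$ with $u*\varphi\in L^\infty$ for all $\varphi\in\mathcal S$; $S_\beta(t)u$ is regarded as defined for these $u$). Let $E,F$ be Banach spaces with $\mathcal S\subset E\subset\mathcal S'$ and $\mathcal S\subset F\subset\mathcal S'$ continuously, whose norms are invariant under translations, and which contain the averages of translates of their elements, i.e. $k*u\in E$ for $k\in L^1(\mathbb R^n)$, $u\in E$, and likewise for $F$. Assume that $E$ and $F$ have scaling degrees $a,b\in\mathbb R$: for $\lambda>0$, $u\in E$, one has $u_\lambda\in E$ and $\|u_\lambda\|_E=\lambda^a\|u\|_E$; likewise for $F$ with $b$. Assume also that $E$ and $F$ belong to the class $\mathcal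 X$: for some $t_0>0$ and $r_0\in[1,\infty]$ (which may differ for $E$ and $F$), $S_\beta(t_0)$ is bounded from the space to $L^{r_0}(\mathbb R^n)$. Let $p,q\ge1$ be integers with $pq>1$, and let $B_1:F^q\to\mathcal S'$ be $q$-linear and $B_2:E^p\to\mathcal S'$ be $p$-linear, with scaling degrees $\sigma_1,\sigma_2\in\mathbb R$: $B_1((v_1)_\lambda,\dots,(v_q)_\lambda)=\lambda^{\sigma_1}[B_1(v_1,\dots,v_q)]_\lambda$ and $B_2((u_1)_\lambda,\dots,(u_p)_\lambda)=\lambda^{\sigma_2}[B_2(u_1,\dots,u_p)]_\lambda$ for all $\lambda>0$. Assume that there are $\omega_1,\omega_2:(0,\infty)\to(0,\infty)$, integrable on $(0,T)$ for every $T<\infty$, with $$\|S_\beta(t)B_1(v_1,\dots,v_q)\|_E\le\omega_1(t)\prod_{i=1}^q\|v_i\|_F,\qquad \|S_\beta(t)B_2(u_1,\dots,u_p)\|_F\le\omega_2(t)\prod_{i=1}^p\|u_i\|_E\qquad(t>0).$$ Let $$\alpha_1=\frac{\beta(1+q)}{pq-1}+a-\frac{\sigma_1+q\sigma_2}{pq-1},\qquad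 \alpha_2=\frac{\beta(1+p)}{pq-1}+b-\frac{\sigma_2+p\sigma_1}{pq-1},$$ and assume $\alpha_1,\alpha_2>0$, $\alpha_1+qb<a+\sigma_1$, $\alpha_2+pa<b+\sigma_2$, $\alpha_1<q\alpha_2$ and $\alpha_2<p\alpha_1$. For $f\in\mathcal S'$ let $\|f\|_{BE^{\alpha_1}}=\sup_{t>0}t^{\alpha_1/\beta}\|S_\beta(t)f\|_E\in[0,\infty]$ ($=\infty$ if some $S_\beta(t)f$, $t>0$, is undefined or not in $E$), let $BE^{\alpha_1}$ be the space where this is finite, and define $BF^{\alpha_2}$ in the same way. Put $\mathcal N(u_0,v_0)=\|u_0\|_{BE^{\alpha_1}}+\|v_0\|_{BF^{\alpha_2}}$ and, for $U=(u,v)$ with $u:(0,\infty)\to E$, $v:(0,\infty)\to F$, $$\|U\|=\sup_{t>0}t^{\alpha_1/\beta}\|u(t)\|_E+\sup_{t>0}\|u(t)\|_{BE^{\alpha_1}}+\sup_{t>0}t^{\alpha_2/\beta}\|v(t)\|_F+\sup_{t>0}\|v(t)\|_{BF^{\alpha_2}}.$$ A solution with data $(u_0,v_0)$ is a pair $U=(u,v)$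 such that for every $t>0$ $$u(t)=S_\beta(t)u_0+\int_0^tS_\beta(t-\tau)B_1(v(\tau),\dots,v(\tau))\,d\tau,\qquad v(t)=S_\beta(t)v_0+\int_0^tS_\beta(t-\tau)B_2(u(\tau),\dots,u(\tau))\,d\tau,$$ with $S_\beta(t)u_0\in E$, $S_\beta(t)v_0\in F$ and Bochner integrals in $E$ and in $F$. Then there are constants $C_1,C_2>0$ such that, for all $t>0$ and all $v_i\in F$, $u_i\in E$, $$\|S_\beta(t)B_1(v_1,\dots,v_q)\|_E\le C_1t^{(qb-a-\sigma_1)/\beta}\prod_{i=1}^q\|v_i\|_F,\qquad \|S_\beta(t)B_2(u_1,\dots,u_p)\|_F\le C_2t^{(pa-b-\sigma_2)/\beta}\prod_{i=1}^p\|u_i\|_E .$$ For any such $C_1,C_2$, set $$K_1=C_1\int_0^1\Big[(1-s)^{\frac{qb-a-\sigma_1}{\beta}}+(1-s)^{\frac{\alpha_1+qb-a-\sigma_1}{\beta}}\Big]s^{-\frac{q\alpha_2}{\beta}}ds,\qquad K_2=C_2\int_0^1\Big[(1-s)^{\frac{pa-b-\sigma_2}{\beta}}+(1-s)^{\frac{\alpha_2+pa-b-\sigma_2}{\beta}}\Big]s^{-\frac{p\alpha_1}{\beta}}ds,$$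 and let $M,R>0$ satisfy $2R+qM^qK_1+pM^pK_2<M$. Then for all $\Phi=(u_0,v_0)$ with $\mathcal N(\Phi)\le R$ there is a unique solution $U=(u,v)$ on $(0,\infty)$ with data $\Phi$ and $\|U\|\le M$. Moreover, if $\overline U$ is a solution with data $\overline\Phi$, $\mathcal N(\overline\Phi)\le R$ and $\|\overline U\|\le M$, then $$\|U-\overline U\|\le 2\,\big[1-(qM^{q-1}K_1+pM^{p-1}K_2)\big]^{-1}\,\mathcal N(\Phi-\overline\Phi).$$ -/

import Mathlib

open MeasureTheory Set
open scoped SchwartzMap ENNReal NNReal FourierTransform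

noncomputable section

namespace FracSystem

/-- The space `ℝⁿ` with its Euclidean norm. -/
abbrev Rn (n : ℕ) : Type := EuclideanSpace ℝ (Fin n)

/-- The tempered distributions on `ℝⁿ` with scalars `𝕜` (real or complex), with the topology of
pointwise convergence on test functions. For `𝕜 = ℂ` this is Mathlib's `𝓢'(ℝⁿ, ℂ)`. -/
abbrev Tempered (𝕜 : Type*) [RCLike 𝕜] (n : ℕ) : Type _ := 𝓢(Rn n, 𝕜) →Lₚₜ[𝕜] 𝕜

section Distributions

variable {𝕜 : Type*} [RCLike 𝕜] {n : ℕ}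

/-- The translate `T_y f = f(· - y)`, that is `⟨T_y f, φ⟩ = ⟨f, φ(· + y)⟩`. -/
def translate (y : Rn n) (f : Tempered 𝕜 n) : Tempered 𝕜 n :=
  f.comp (SchwartzMap.compSubConstCLM 𝕜 (-y))

/-- The dilate `f_l = f(l ·)`, that is `⟨f_l, φ⟩ = l⁻ⁿ ⟨f, φ(l⁻¹ ·)⟩`, for `l > 0`. -/
def dilate (l : ℝ) (hl : 0 < l) (f : Tempered 𝕜 n) : Tempered 𝕜 n :=
  (((l ^ n)⁻¹ : ℝ) : 𝕜) • f.comp (SchwartzMap.compCLMOfContinuousLinearEquiv 𝕜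
    (ContinuousLinearEquiv.smulLeft (M₁ := Rn n) (R₁ := ℝ) (Units.mk0 l⁻¹ (inv_ne_zero hl.ne'))))

/-- The distribution `f` is given by integration against the function `g`. -/
def IsFunction (g : Rn n → 𝕜) (f : Tempered 𝕜 n) : Prop :=
  ∀ φ : 𝓢(Rn n, 𝕜), f φ = ∫ x, g x * φ x

/-- Bounded distributions in the sense of Schwartz: the convolution of `f` with every Schwartz
function is a bounded function. -/
def IsBoundedDistribution (f : Tempered 𝕜 n) : Prop :=
  ∀ φ : 𝓢(Rn n, 𝕜), ∃ C : ℝ, ∀ y : Rn n, ‖translate y f φ‖ ≤ C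

/-- `g = k * f`, the convolution of an integrable function `k` and a bounded distribution `f`:
`⟨k * f, φ⟩ = ∫ k(y) ⟨T_y f, φ⟩ dy` for every test function `φ`. -/
def IsConvolution (k : Rn n → ℝ) (f g : Tempered 𝕜 n) : Prop :=
  ∀ φ : 𝓢(Rn n, 𝕜), g φ = ∫ y, k y • translate y f φ

/-- The kernel `K_β(t, ·) = 𝓕⁻¹(exp(-t|ξ|^β))` (with `2π` in the exponent of the Fourier
transform). The inverse transform of this even real function is real. -/
def kernel (β t : ℝ) (x : Rn n) : ℝ :=
  (𝓕⁻ (fun ξ : Rn n ↦ ((Real.exp (-t * ‖ξ‖ ^ β) : ℝ) : ℂ)) x).re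

/-- `g = S_β(t) f = K_β(t, ·) * f`. The kernel is integrable for all `β, t > 0`, but it is not a
Schwartz function unless `β` is an even integer, so the convolution is that of an integrable
function and a bounded distribution. -/
def IsEvolution (β t : ℝ) (f g : Tempered 𝕜 n) : Prop :=
  IsBoundedDistribution f ∧ IsConvolution (kernel β t) f g

end Distributions

section Spaces

variable {𝕜 : Type*} [RCLike 𝕜] {n : ℕ} {E : Type*} [NormedAddCommGroup E] [NormedSpace 𝕜 E]

/-- The Banach space `E`, embedded in `𝓢'` by `ι`, is a translation invariant space of tempered
distributions: `𝓢 ⊂ E ⊂ 𝓢'` with continuous injections, translations act isometrically on `E`, and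
`E` contains the averages of translates of its elements, i.e. the convolutions `k * u` with
integrable `k`. -/
structure IsTranslationInvariantSpace (ι : E →L[𝕜] Tempered 𝕜 n) : Prop where
  injective : Function.Injective ι
  schwartz : ∃ j : 𝓢(Rn n, 𝕜) →L[𝕜] E, ∀ φ : 𝓢(Rn n, 𝕜),
    IsFunction (fun x ↦ φ x) (ι (j φ))
  translation : ∀ (u : E) (y : Rn n), ∃ w : E, ι w = translate y (ι u) ∧ ‖w‖ = ‖u‖
  convolution : ∀ k : Rn n → ℝ, Integrable k → ∀ u : E, ∃ w : E, IsConvolution k (ι u) (ι w)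

/-- The norm of `E` has scaling degree `a`: `‖u_l‖ = l^a ‖u‖`. -/
def HasScalingDegree (ι : E →L[𝕜] Tempered 𝕜 n) (a : ℝ) : Prop :=
  ∀ (u : E) (l : ℝ) (hl : 0 < l), ∃ w : E, ι w = dilate l hl (ι u) ∧ ‖w‖ = l ^ a * ‖u‖

/-- The class `𝒳`: for some `t₀ > 0` and `r₀ ∈ [1, ∞]`, the operator `S_β(t₀)` is bounded from `E`
to `L^{r₀}`. -/
def InClassX (β : ℝ) (ι : E →L[𝕜] Tempered 𝕜 n) : Prop :=
  ∃ t₀ : ℝ, 0 < t₀ ∧ ∃ r₀ : ℝ≥0∞, 1 ≤ r₀ ∧ ∃ C : ℝ≥0, ∀ u : E, ∃ g : Rn n → 𝕜,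
    MemLp g r₀ ∧ eLpNorm g r₀ volume ≤ C * ‖u‖ₑ ∧
      ∃ f : Tempered 𝕜 n, IsEvolution β t₀ (ι u) f ∧ IsFunction g f

/-- The norm `‖f‖_{BE^α} = sup_{t > 0} t^{α/β} ‖S_β(t) f‖_E ∈ [0, ∞]` of a tempered distribution.
The infimum is over the (at most one) element of `E` that equals `S_β(t) f`, so it is `∞` when
`S_β(t) f` is not in `E`; `f` belongs to `BE^α` if and only if the norm is finite. -/
def beNorm (β α : ℝ) (ι : E →L[𝕜] Tempered 𝕜 n) (f : Tempered 𝕜 n) : ℝ≥0∞ :=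
  ⨆ (t : ℝ) (_ : 0 < t), ENNReal.ofReal (t ^ (α / β)) *
    ⨅ (w : E) (_ : IsEvolution β t f (ι w)), ‖w‖ₑ

/-- `sup_{t > 0} t^{α/β} ‖u(t)‖_E + sup_{t > 0} ‖u(t)‖_{BE^α} ∈ [0, ∞]`. -/
def pathNorm (β α : ℝ) (ι : E →L[𝕜] Tempered 𝕜 n) (u : ℝ → E) : ℝ≥0∞ :=
  (⨆ (t : ℝ) (_ : 0 < t), ENNReal.ofReal (t ^ (α / β)) * ‖u t‖ₑ) +
    ⨆ (t : ℝ) (_ : 0 < t), beNorm β α ι (ι (u t))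

/-- `u(t) = S_β(t) u₀ + ∫₀ᵗ S_β(t - τ) h(τ) dτ` in `E` for every `t > 0`, where `S_β(t) u₀` and
`S_β(t - τ) h(τ)`, `0 < τ < t`, lie in `E` and the integral is a Bochner integral in `E`. -/
def IsDuhamel [NormedSpace ℝ E] (β : ℝ) (ι : E →L[𝕜] Tempered 𝕜 n) (u₀ : Tempered 𝕜 n)
    (h : ℝ → Tempered 𝕜 n) (u : ℝ → E) : Prop :=
  ∀ t : ℝ, 0 < t → ∃ (x : E) (g : ℝ → E), IsEvolution β t u₀ (ι x) ∧
    (∀ τ ∈ Ioo 0 t, IsEvolution β (t - τ) (h τ) (ι (g τ))) ∧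
    IntegrableOn g (Ioo 0 t) ∧ u t = x + ∫ τ in Ioo 0 t, g τ

end Spaces

section Forms

variable {𝕜 : Type*} [RCLike 𝕜] {n : ℕ} {E F : Type*} [NormedAddCommGroup E] [NormedSpace 𝕜 E]
  [NormedAddCommGroup F] [NormedSpace 𝕜 F]

/-- The `m`-linear form `B : F^m → 𝓢'` has scaling degree `σ`:
`B((v₁)_l, …, (v_m)_l) = l^σ [B(v₁, …, v_m)]_l`. -/
def FormHasScalingDegree {m : ℕ} (ι : F →L[𝕜] Tempered 𝕜 n)
    (B : MultilinearMap 𝕜 (fun _ : Fin m ↦ F) (Tempered 𝕜 n)) (σ : ℝ) : Prop :=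
  ∀ (l : ℝ) (hl : 0 < l) (v w : Fin m → F), (∀ i, ι (w i) = dilate l hl (ι (v i))) →
    B w = ((l ^ σ : ℝ) : 𝕜) • dilate l hl (B v)

/-- `S_β(t) B(v₁, …, v_m) ∈ E` and `‖S_β(t) B(v₁, …, v_m)‖_E ≤ ω(t) ∏ ‖v_i‖_F` for all `t > 0`. -/
def SmoothingBound {m : ℕ} (β : ℝ) (ι : E →L[𝕜] Tempered 𝕜 n)
    (B : MultilinearMap 𝕜 (fun _ : Fin m ↦ F) (Tempered 𝕜 n)) (ω : ℝ → ℝ) : Prop :=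
  ∀ t : ℝ, 0 < t → ∀ v : Fin m → F, ∃ w : E,
    IsEvolution β t (B v) (ι w) ∧ ‖w‖ ≤ ω t * ∏ i, ‖v i‖

/-- `E × F` is adequate to the system with right-hand sides `B₁` and `B₂`. -/
structure IsAdequate {p q : ℕ} (β : ℝ) (ιE : E →L[𝕜] Tempered 𝕜 n) (ιF : F →L[𝕜] Tempered 𝕜 n)
    (B₁ : MultilinearMap 𝕜 (fun _ : Fin q ↦ F) (Tempered 𝕜 n))
    (B₂ : MultilinearMap 𝕜 (fun _ : Fin p ↦ E) (Tempered 𝕜 n)) : Prop where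
  left : IsTranslationInvariantSpace ιE
  right : IsTranslationInvariantSpace ιF
  bound₁ : ∃ ω : ℝ → ℝ, (∀ t, 0 < t → 0 < ω t) ∧ (∀ T, 0 < T → IntegrableOn ω (Ioo 0 T)) ∧
    SmoothingBound β ιE B₁ ω
  bound₂ : ∃ ω : ℝ → ℝ, (∀ t, 0 < t → 0 < ω t) ∧ (∀ T, 0 < T → IntegrableOn ω (Ioo 0 T)) ∧
    SmoothingBound β ιF B₂ ω

/-- `(u, v)` solves the integral system with initial data `(u₀, v₀)` on `(0, ∞)`. -/
def IsSolution {p q : ℕ} [NormedSpace ℝ E] [NormedSpace ℝ F] (β : ℝ)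
    (ιE : E →L[𝕜] Tempered 𝕜 n) (ιF : F →L[𝕜] Tempered 𝕜 n)
    (B₁ : MultilinearMap 𝕜 (fun _ : Fin q ↦ F) (Tempered 𝕜 n))
    (B₂ : MultilinearMap 𝕜 (fun _ : Fin p ↦ E) (Tempered 𝕜 n))
    (u₀ v₀ : Tempered 𝕜 n) (u : ℝ → E) (v : ℝ → F) : Prop :=
  IsDuhamel β ιE u₀ (fun τ ↦ B₁ fun _ ↦ v τ) u ∧ IsDuhamel β ιF v₀ (fun τ ↦ B₂ fun _ ↦ u τ) v

end Forms

/-- `C (∫₀¹ (1 - s)^{-γ/β} s^{-κ/β} ds + ∫₀¹ (1 - s)^{(α - γ)/β} s^{-κ/β} ds)`. -/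
def betaConst (β C α γ κ : ℝ) : ℝ :=
  C * ((∫ s in (0 : ℝ)..1, (1 - s) ^ (-γ / β) * s ^ (-κ / β)) +
    ∫ s in (0 : ℝ)..1, (1 - s) ^ ((α - γ) / β) * s ^ (-κ / β))

end FracSystem

end

noncomputable section

/-! For fixed data the right-hand side of the system is a contraction for the norms `sup t^(α₁/β)
‖u(t)‖_E` and `sup t^(α₂/β) ‖v(t)‖_F`. Put `γ₁ = a + σ₁ - q b`, so that scaling turns the smoothing
bound at time 1 into the power `t^(-γ₁/β)`. The formulas for `α₁, α₂` say exactly that `q α₂ = α₁ +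
β - γ₁`; hence `∫₀ᵗ (t - τ)^(-γ₁/β) τ^(-q α₂/β) dτ` is a Beta integral times `t^(-α₁/β)`, and the
weights reproduce themselves. It converges at `τ = t` because `γ₁ < β`, which is `α₁ < q α₂`, and at
`τ = 0` because `q α₂ < β`, which is `α₁ < γ₁`. The second equation is symmetric. For the `BE` part
of the norm, `S_β(s)` applied to the integrand is smoothing for the time `s + t - τ`, and a split of
the power gives the second Beta integral (`pathNorm_setIntegral_le`).

A single estimate for the difference of two Duhamel formulas (`IsDuhamel.pathNorm_sub_le`) serves
for everything: equal data give the contraction and uniqueness, comparison with the zero solution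
gives the self-mapping property, and the general case gives continuous dependence. The contraction
is run among continuous paths, so that the integrands are measurable (`exists_isDuhamel`);
uniqueness and stability need no continuity (`IsSolution.pathNorm_sub_le`).

The remaining work gives `S_β(t)` a meaning on the abstract space `E`. The kernel is integrable
(`exists_fourier_eq_symbol`): the high frequencies of the symbol are Schwartz, and the low
frequencies come from an operator exponential on `L¹`. By scaling and Scheffé's lemma the kernel is
`L¹`-continuous in `t > 0`. The closed graph theorem makes `k * u` a bounded bilinear map `E × L¹ →
E` (`convolutionCLM`), so `S_β(t)` is norm continuous for `t > 0`. -/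

namespace FracSystem

/-! ### High frequencies of the symbol -/

section Multipliers

open Filter Topology
open scoped ContDiff

/-- The Gaussian `exp (-x² / 2)` as a Schwartz function on the line. -/
def gaussianSchwartz : 𝓢(ℝ, ℝ) where
  toFun x := Real.exp (-(x ^ 2 / 2))
  smooth' := by fun_prop
  decay' k m := by
    have hcont : Continuous fun x : ℝ ↦
        ‖x‖ ^ k * ‖iteratedFDeriv ℝ m (fun x : ℝ ↦ Real.exp (-(x ^ 2 / 2))) x‖ := by
      refine (continuous_norm.pow k).mul (ContDiff.continuous_iteratedFDeriv (n := ∞) ?_ ?_).norm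
      · exact mod_cast le_top
      · fun_prop
    -- Derivatives of the Gaussian are, up to sign, Hermite polynomials times the Gaussian, so every
    -- seminorm is the supremum of a polynomial times the Gaussian: continuous and vanishing at
    -- infinity.
    let P : Polynomial ℝ := Polynomial.X ^ k * (Polynomial.hermite m).map (Int.castRingHom ℝ)
    have heq : ∀ x : ℝ, ‖x‖ ^ k * ‖iteratedFDeriv ℝ m (fun x : ℝ ↦ Real.exp (-(x ^ 2 / 2))) x‖
        = ‖P.eval x * Real.exp (-(x ^ 2 / 2))‖ := by
      intro x
      rw [norm_iteratedFDeriv_eq_norm_iteratedDeriv, iteratedDeriv_eq_iterate,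
        Polynomial.deriv_gaussian_eq_hermite_mul_gaussian]
      simp [P, norm_mul, Polynomial.aeval_def, Polynomial.eval_map, mul_assoc]
    have hP : ∀ Q : Polynomial ℝ,
        Tendsto (fun x ↦ Q.eval x * Real.exp (-(x ^ 2 / 2))) (cocompact ℝ) (𝓝 0) := by
      intro Q
      induction Q using Polynomial.induction_on' with
      | add p q hp hq => simpa [add_mul] using hp.add hq
      | monomial d a =>
        have h := (tendsto_rpow_abs_mul_exp_neg_mul_sq_cocompact (a := 1 / 2) (by norm_num)
          d).const_mul ‖a‖
        rw [mul_zero] at h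
        rw [tendsto_zero_iff_norm_tendsto_zero]
        refine h.congr fun x ↦ ?_
        simp only [Polynomial.eval_monomial, norm_mul, norm_pow, Real.norm_eq_abs, Real.abs_exp,
          Real.rpow_natCast, mul_assoc]
        congr 4
        ring
    have hlim := (hP P).norm
    rw [norm_zero] at hlim
    obtain ⟨C, hC⟩ : ∃ C, ∀ x : ℝ, ‖P.eval x * Real.exp (-(x ^ 2 / 2))‖ ≤ C := by
      have hev := hlim.eventually (eventually_le_nhds zero_lt_one)
      obtain ⟨S, hS, hSc⟩ := mem_cocompact.1 hev
      obtain ⟨C, hC⟩ := hS.bddAbove_image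
        (f := fun x : ℝ ↦ ‖P.eval x * Real.exp (-(x ^ 2 / 2))‖)
        (by
          have : Continuous fun x : ℝ ↦ ‖P.eval x * Real.exp (-(x ^ 2 / 2))‖ := by fun_prop
          exact this.continuousOn)
      refine ⟨max C 1, fun x ↦ ?_⟩
      by_cases hx : x ∈ S
      · exact (hC (mem_image_of_mem _ hx)).trans (le_max_left _ _)
      · exact le_trans (hSc hx) (le_max_right _ _)
    exact ⟨C, fun x ↦ (heq x).trans_le (hC x)⟩

/-- A real power of a function of temperate growth is of temperate growth, if the function takes
values larger than `1`. -/
lemma hasTemperateGrowth_rpow {H : Type*} [NormedAddCommGroup H] [NormedSpace ℝ H] {f : H → ℝ}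
    (hf : f.HasTemperateGrowth) (h1 : ∀ x, 1 < f x) (r : ℝ) :
    (fun x ↦ f x ^ r).HasTemperateGrowth := by
  set s := {y : ℝ | 1 < y}
  have hs : Set.range f ⊆ s := by rintro - ⟨y, rfl⟩; exact h1 y
  have hdiff : ContDiffOn ℝ ∞ (fun x ↦ x ^ r) s :=
    contDiffOn_fun_id.rpow_const_of_ne fun x hx ↦ (lt_trans (by norm_num) hx).ne'
  have hunique : UniqueDiffOn ℝ s := (isOpen_lt' 1).uniqueDiffOn
  refine Function.HasTemperateGrowth.comp' hs hunique hdiff (fun N ↦ ?_) hf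
  -- On `y > 1` negative powers are harmless: `y^(r - m) ≤ y^k` for all `m` once `k ≥ r`.
  obtain ⟨k, hk⟩ := exists_nat_ge r
  refine ⟨k, ∑ k ∈ Finset.range (N + 1), ‖Polynomial.eval r (descPochhammer ℝ k)‖,
    by positivity, fun m hm x hx ↦ ?_⟩
  have hx1 : 1 < x := hx
  have hx0 : 0 < x := one_pos.trans hx1
  have : ContDiffAt ℝ m (fun x ↦ x ^ r) x := Real.contDiffAt_rpow_const <| Or.inl hx0.ne'
  rw [norm_iteratedFDerivWithin_eq_norm_iteratedDerivWithin,
    iteratedDerivWithin_eq_iteratedDeriv hunique this hx, iteratedDeriv_eq_iterate,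
    Real.iter_deriv_rpow_const, norm_mul]
  gcongr 1
  · exact Finset.single_le_sum (f := fun k ↦ ‖Polynomial.eval r (descPochhammer ℝ k)‖)
      (fun _ _ ↦ by positivity) (by grind)
  · rw [Real.norm_of_nonneg (by positivity), ← Real.rpow_natCast, Real.norm_of_nonneg hx0.le]
    calc x ^ (r - m) ≤ x ^ (k : ℝ) :=
          Real.rpow_le_rpow_of_exponent_le hx1.le (by linarith [(Nat.cast_nonneg m : (0:ℝ) ≤ m)])
      _ ≤ (1 + x) ^ (k : ℝ) := by gcongr; linarith

variable {n : ℕ}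

/-- The symbol `exp (-t |ξ|^β)` of the fractional heat semigroup. -/
def symbol (β t : ℝ) (ξ : Rn n) : ℂ := (Real.exp (-t * ‖ξ‖ ^ β) : ℝ)

/-- A smooth cut-off function, equal to `1` on the unit ball and supported in the ball of
radius `2`. -/
def cutoff (n : ℕ) : ContDiffBump (0 : Rn n) := ⟨1, 2, one_pos, one_lt_two⟩

lemma cutoff_eq_one {ξ : Rn n} (h : ‖ξ‖ ≤ 1) : cutoff n ξ = 1 :=
  (cutoff n).one_of_mem_closedBall (by simpa [cutoff] using h)

lemma cutoff_eq_zero {ξ : Rn n} (h : 2 ≤ ‖ξ‖) : cutoff n ξ = 0 :=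
  (cutoff n).zero_of_le_dist (by simpa [cutoff] using h)

lemma contDiff_cutoff_smul (c : ℝ) : ContDiff ℝ ∞ fun ξ : Rn n ↦ cutoff n (c • ξ) :=
  (cutoff n).contDiff.comp (contDiff_const_smul c)

lemma hasCompactSupport_cutoff_smul {c : ℝ} (hc : c ≠ 0) :
    HasCompactSupport fun ξ : Rn n ↦ cutoff n (c • ξ) :=
  (cutoff n).hasCompactSupport.comp_smul hc

/-- Away from the origin `exp(-t|ξ|^β)` is the Gaussian `exp(-y²/2)` at `y = √(2t) |ξ|^(β/2)`. Once
`y` is smoothed near the origin, composition with it preserves Schwartz functions, and the factor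
vanishing near the origin hides the modification. -/
lemma exists_schwartz_high_frequency {β t : ℝ} (hβ : 0 < β) (ht : 0 < t) :
    ∃ φ : 𝓢(Rn n, ℂ), ∀ ξ, φ ξ = (1 - (cutoff n ((2 : ℝ) • ξ) : ℂ)) * symbol β t ξ := by
  -- The cut-off keeps `f` positive at the origin and vanishes for `|ξ| ≥ 1/2`, where `f = 32|ξ|²`.
  -- The factor 32 makes `f > 1` also for `|ξ| > 1/4`.
  set f : Rn n → ℝ := fun ξ ↦ 32 * (cutoff n ((4 : ℝ) • ξ) + ‖ξ‖ ^ 2) with hf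
  have hf1 : ∀ ξ, 1 < f ξ := by
    intro ξ
    simp only [hf]
    rcases le_or_gt ‖ξ‖ (1 / 4) with h | h
    · rw [cutoff_eq_one (by rw [norm_smul]; norm_num; linarith)]
      nlinarith [sq_nonneg ‖ξ‖]
    · have := (cutoff n).nonneg (x := (4 : ℝ) • ξ)
      nlinarith
  have hft : f.HasTemperateGrowth := by
    have h := (hasCompactSupport_cutoff_smul (n := n) (c := 4) (by norm_num)).hasTemperateGrowth
      (contDiff_cutoff_smul 4)
    exact (Function.HasTemperateGrowth.const 32).mul
      (h.add (Function.hasTemperateGrowth_norm_sq (Rn n)))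
  -- Chosen so that `g² / 2 = t|ξ|^β` wherever `f = 32|ξ|²`.
  set c : ℝ := √(2 * t) / 32 ^ (β / 4) with hc
  have hc0 : 0 < c := by positivity
  set g : Rn n → ℝ := fun ξ ↦ c * f ξ ^ (β / 4) with hg
  have hgt : g.HasTemperateGrowth :=
    (Function.HasTemperateGrowth.const c).mul (hasTemperateGrowth_rpow hft hf1 _)
  -- Composition needs `g` to grow at least like a power; `|ξ| ≤ √f` and `√f = (f^(β/4))^(2/β)`,
  -- whence `k ≥ 2/β`.
  have hupper : ∃ (k : ℕ) (C : ℝ), ∀ ξ, ‖ξ‖ ≤ C * (1 + ‖g ξ‖) ^ k := by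
    obtain ⟨k, hk⟩ := exists_nat_ge (2 / β)
    refine ⟨k, (1 + c⁻¹) ^ k, fun ξ ↦ ?_⟩
    have hf0 : 0 < f ξ := one_pos.trans (hf1 ξ)
    have h1 : 1 ≤ f ξ ^ (β / 4) := Real.one_le_rpow (hf1 ξ).le (by positivity)
    have hgn : ‖g ξ‖ = c * f ξ ^ (β / 4) := Real.norm_of_nonneg (by positivity)
    calc ‖ξ‖ = (‖ξ‖ ^ 2) ^ (1 / 2 : ℝ) := by rw [← Real.sqrt_eq_rpow, Real.sqrt_sq (norm_nonneg _)]
      _ ≤ f ξ ^ (1 / 2 : ℝ) := by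
        gcongr
        have := (cutoff n).nonneg (x := (4 : ℝ) • ξ)
        simp only [hf]; nlinarith [sq_nonneg ‖ξ‖]
      _ = (f ξ ^ (β / 4)) ^ (2 / β) := by
        rw [← Real.rpow_mul hf0.le]; congr 1; field_simp; norm_num
      _ ≤ (f ξ ^ (β / 4)) ^ (k : ℝ) := Real.rpow_le_rpow_of_exponent_le h1 hk
      _ = (f ξ ^ (β / 4)) ^ k := Real.rpow_natCast _ _
      _ ≤ ((1 + c⁻¹) * (1 + ‖g ξ‖)) ^ k := by
        gcongr
        rw [hgn]
        have : c⁻¹ * (c * f ξ ^ (β / 4)) = f ξ ^ (β / 4) := by field_simp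
        nlinarith [inv_pos.2 hc0, mul_pos hc0 (one_pos.trans_le h1)]
      _ = _ := mul_pow _ _ _
  let Ψ : 𝓢(Rn n, ℂ) := (SchwartzMap.compCLM ℝ hgt hupper gaussianSchwartz).postcompCLM
    (𝕜 := ℝ) Complex.ofRealCLM
  have hχ : (fun ξ : Rn n ↦ 1 - (cutoff n ((2 : ℝ) • ξ) : ℂ)).HasTemperateGrowth := by
    have h := (hasCompactSupport_cutoff_smul (n := n) (c := 2) (by norm_num)).hasTemperateGrowth
      (contDiff_cutoff_smul 2)
    exact (Function.HasTemperateGrowth.const 1).sub (Complex.ofRealCLM.hasTemperateGrowth.comp h)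
  refine ⟨SchwartzMap.smulLeftCLM ℂ (fun ξ : Rn n ↦ 1 - (cutoff n ((2 : ℝ) • ξ) : ℂ)) Ψ,
    fun ξ ↦ ?_⟩
  rw [SchwartzMap.smulLeftCLM_apply_apply hχ, smul_eq_mul]
  rcases le_or_gt ‖ξ‖ (1 / 2) with h | h
  · rw [cutoff_eq_one (by rw [norm_smul]; norm_num; linarith)]; simp
  · congr 1
    simp only [Ψ, SchwartzMap.postcompCLM_apply, symbol, SchwartzMap.compCLM_apply]
    have : f ξ = 32 * ‖ξ‖ ^ 2 := by
      simp only [hf]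
      rw [cutoff_eq_zero (by rw [norm_smul]; norm_num; linarith), zero_add]
    have hsq : (g ξ) ^ 2 = 2 * (t * ‖ξ‖ ^ β) := by
      simp only [hg, this, hc]
      rw [Real.mul_rpow (by norm_num) (by positivity), ← Real.rpow_natCast ‖ξ‖ 2,
        ← Real.rpow_mul (norm_nonneg _), ← mul_assoc, div_mul_cancel₀ _ (by positivity), mul_pow,
        Real.sq_sqrt (by positivity), ← Real.rpow_natCast (‖ξ‖ ^ _) 2,
        ← Real.rpow_mul (norm_nonneg _), mul_assoc]
      congr 3
      push_cast; ring
    change ((Real.exp (-((g ξ) ^ 2 / 2)) : ℝ) : ℂ) = _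
    rw [hsq]
    congr 2; ring

end Multipliers

/-! ### Integrability, semigroup law and scaling of the kernel -/

section Kernel

open Filter Topology ContinuousLinearMap
open scoped ContDiff

variable {n : ℕ}

lemma fourier_comp_smul (f : Rn n → ℂ) {c : ℝ} (hc : 0 < c) (ξ : Rn n) :
    𝓕 (fun x ↦ f (c • x)) ξ = (c ^ n)⁻¹ • 𝓕 f (c⁻¹ • ξ) := by
  have h := Measure.integral_comp_smul (volume : Measure (Rn n))
    (fun x ↦ Real.fourierChar (-inner ℝ x (c⁻¹ • ξ)) • f x) c
  rw [finrank_euclideanSpace_fin, abs_of_pos (by positivity)] at h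
  rw [Real.fourier_eq, Real.fourier_eq, ← h]
  congr 1 with x
  rw [real_inner_smul_left, real_inner_smul_right, mul_inv_cancel_left₀ hc.ne']

/-- Fourier inversion for integrable functions with integrable Fourier transform. -/
lemma ae_eq_fourierInv_fourier {W : Rn n → ℂ} (hW : Integrable W) (hFW : Integrable (𝓕 W)) :
    W =ᵐ[volume] 𝓕⁻ (𝓕 W) := by
  have hcont : Continuous (𝓕⁻ (𝓕 W)) := by
    have := VectorFourier.fourierIntegral_continuous (L := innerₗ (Rn n)) (μ := volume)
      Real.continuous_fourierChar (innerSL ℝ).continuous₂ hFW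
    have h2 : 𝓕⁻ (𝓕 W) = fun x ↦ 𝓕 (𝓕 W) (-x) := by
      ext x; rw [Real.fourierInv_eq_fourier_neg]
    rw [h2]
    exact this.comp continuous_neg
  refine ae_eq_of_integral_contDiff_smul_eq hW.locallyIntegrable hcont.locallyIntegrable
    fun g hg hgc ↦ ?_
  let φ : 𝓢(Rn n, ℂ) := HasCompactSupport.toSchwartzMap (f := fun x ↦ (g x : ℂ))
    (hgc.comp_left (g := Complex.ofReal) Complex.ofReal_zero)
    (Complex.ofRealCLM.contDiff.comp hg)
  let ψ : 𝓢(Rn n, ℂ) := 𝓕⁻ φ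
  have hψ : 𝓕 (ψ : Rn n → ℂ) = φ := by
    rw [← SchwartzMap.fourier_coe]; simp [ψ]
  -- The Fourier transform is moved to the test function twice, once from `W` and once from `𝓕 W`;
  -- inversion for Schwartz functions then identifies both pairings.
  have e1 : ∫ ξ, 𝓕 W ξ • ψ ξ = ∫ x, W x • 𝓕 (ψ : Rn n → ℂ) x :=
    VectorFourier.integral_fourierIntegral_smul_eq_flip (L := innerₗ (Rn n))
      Real.continuous_fourierChar (innerSL ℝ).continuous₂ hW ψ.integrable |>.trans
      (by rw [flip_innerₗ]; rfl)
  have e2 : ∫ x, 𝓕 (𝓕 W) x • φ (-x) = ∫ ξ, 𝓕 W ξ • 𝓕 (fun x ↦ φ (-x)) ξ :=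
    VectorFourier.integral_fourierIntegral_smul_eq_flip (L := innerₗ (Rn n))
      Real.continuous_fourierChar (innerSL ℝ).continuous₂ hFW φ.integrable.comp_neg |>.trans
      (by rw [flip_innerₗ]; rfl)
  have e3 : 𝓕 (fun x ↦ φ (-x)) = ψ := by
    change _ = ((𝓕⁻ φ : 𝓢(Rn n, ℂ)) : Rn n → ℂ)
    rw [SchwartzMap.fourierInv_coe, Real.fourierInv_eq_fourier_comp_neg]
  have e4 : ∫ x, 𝓕⁻ (𝓕 W) x • φ x = ∫ x, 𝓕 (𝓕 W) x • φ (-x) := by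
    rw [← integral_neg_eq_self]
    congr 1 with x
    rw [Real.fourierInv_eq_fourier_neg, neg_neg]
  have hφ : ∀ x, φ x = (g x : ℂ) := fun x ↦ rfl
  have key : ∫ x, W x • φ x = ∫ x, 𝓕⁻ (𝓕 W) x • φ x := by
    rw [e4, e2, e3, e1, hψ]
  simpa only [hφ, smul_eq_mul, mul_comm, Complex.real_smul] using key

/-- Convolution with an integrable function, as an operator on `L¹`. -/
def convL1 (h : Lp ℂ 1 (volume : Measure (Rn n))) :
    Lp ℂ 1 (volume : Measure (Rn n)) →L[ℂ] Lp ℂ 1 (volume : Measure (Rn n)) :=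
  LinearMap.mkContinuous
    { toFun u := ((L1.integrable_coeFn h).integrable_convolution (mul ℂ ℂ)
        (L1.integrable_coeFn u)).toL1
      map_add' u v := by
        rw [← Integrable.toL1_add]
        refine (Integrable.toL1_eq_toL1_iff _ _ _ _).2 ?_
        rw [convolution_congr (mul ℂ ℂ) (ae_eq_refl h) (Lp.coeFn_add u v)]
        filter_upwards [(L1.integrable_coeFn h).ae_convolution_exists (mul ℂ ℂ)
          (L1.integrable_coeFn u), (L1.integrable_coeFn h).ae_convolution_exists (mul ℂ ℂ)
          (L1.integrable_coeFn v)] with x hu hv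
        exact hu.distrib_add hv
      map_smul' c u := by
        rw [RingHom.id_apply, ← Integrable.toL1_smul]
        refine (Integrable.toL1_eq_toL1_iff _ _ _ _).2 ?_
        rw [convolution_congr (mul ℂ ℂ) (ae_eq_refl h) (Lp.coeFn_smul c u), convolution_smul]
        rfl }
    ‖h‖ fun u ↦ by
      have hc := (L1.integrable_coeFn h).norm.integrable_convolution (mul ℝ ℝ)
        (L1.integrable_coeFn u).norm
      rw [LinearMap.coe_mk, AddHom.coe_mk, L1.norm_eq_integral_norm h, L1.norm_eq_integral_norm u,
        L1.norm_eq_integral_norm]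
      have h2 := integral_convolution (mul ℝ ℝ) (L1.integrable_coeFn h).norm
        (L1.integrable_coeFn u).norm
      rw [mul_apply'] at h2
      rw [← h2]
      refine integral_mono_ae (L1.integrable_coeFn _).norm hc ?_
      filter_upwards [Integrable.coeFn_toL1 ((L1.integrable_coeFn h).integrable_convolution
        (mul ℂ ℂ) (L1.integrable_coeFn u))] with x hx
      rw [hx]
      refine (norm_integral_le_integral_norm _).trans_eq ?_
      simp [convolution]

lemma fourier_convL1 (h u : Lp ℂ 1 (volume : Measure (Rn n))) (ξ : Rn n) :
    𝓕 (convL1 h u : Rn n → ℂ) ξ = 𝓕 (h : Rn n → ℂ) ξ * 𝓕 (u : Rn n → ℂ) ξ := by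
  rw [← Real.fourier_mul_convolution_eq (L1.integrable_coeFn h) (L1.integrable_coeFn u)]
  exact Real.fourier_congr_ae (Integrable.coeFn_toL1 ((L1.integrable_coeFn h).integrable_convolution
    (mul ℂ ℂ) (L1.integrable_coeFn u))) ξ

/-- Evaluation of the Fourier transform at `ξ` as a functional on `L¹`. -/
def fourierEval (ξ : Rn n) : Lp ℂ 1 (volume : Measure (Rn n)) →L[ℂ] ℂ :=
  (BoundedContinuousFunction.evalCLM ℂ ξ) ∘L (Real.Lp.fourierTransformCLM (Rn n) ℂ)

lemma fourierEval_apply (ξ : Rn n) (u : Lp ℂ 1 (volume : Measure (Rn n))) :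
    fourierEval ξ u = 𝓕 (u : Rn n → ℂ) ξ := rfl

lemma fourierEval_toL1 (ξ : Rn n) {f : Rn n → ℂ} (hf : Integrable f) :
    fourierEval ξ hf.toL1 = 𝓕 f ξ :=
  Real.fourier_congr_ae (Integrable.coeFn_toL1 _) ξ

/-- If `u` is an eigenvector of `T` for the functional `l`, in the sense that `l ∘ T = c l`, then
`l ∘ exp T = exp c l`. -/
lemma apply_exp_of_forall_apply_eq {A : Type*} [NormedAddCommGroup A] [NormedSpace ℂ A]
    [CompleteSpace A] (T : A →L[ℂ] A) (l : A →L[ℂ] ℂ) (c : ℂ) (h : ∀ u, l (T u) = c * l u)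
    (u : A) : l (NormedSpace.exp T u) = Complex.exp c * l u := by
  have hpow : ∀ (m : ℕ) (u : A), l ((T ^ m) u) = c ^ m * l u := by
    intro m
    induction m with
    | zero => simp
    | succ m ih => intro u; rw [pow_succ, mul_apply_eq_comp, ih, h]; ring
  have h1 := NormedSpace.exp_series_hasSum_exp' (𝕂 := ℂ) T
  have h2 := (h1.mapL (l ∘L ContinuousLinearMap.apply ℂ A u))
  have h3 := (NormedSpace.exp_series_hasSum_exp' (𝕂 := ℂ) c).mul_right (l u)
  rw [Complex.exp_eq_exp_ℂ]
  refine h2.unique (h3.congr_fun fun m ↦ ?_)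
  change l (((m.factorial : ℂ)⁻¹ • T ^ m) u) = _
  rw [smul_apply, map_smul, hpow, smul_eq_mul, smul_eq_mul, mul_assoc]

/-- The annulus piece `|ξ|^β (χ(ξ) - χ(2ξ))` as a Schwartz function. -/
lemma exists_schwartz_annulus (β : ℝ) :
    ∃ φ : 𝓢(Rn n, ℂ), ∀ ξ, φ ξ = ((‖ξ‖ ^ β * (cutoff n ξ - cutoff n ((2 : ℝ) • ξ)) : ℝ) : ℂ) := by
  set f : Rn n → ℝ := fun ξ ↦ ‖ξ‖ ^ β * (cutoff n ξ - cutoff n ((2 : ℝ) • ξ)) with hf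
  have hχ : ContDiff ℝ ∞ fun ξ : Rn n ↦ cutoff n ξ - cutoff n ((2 : ℝ) • ξ) :=
    (cutoff n).contDiff.sub (contDiff_cutoff_smul 2)
  have hsupp : HasCompactSupport f :=
    ((cutoff n).hasCompactSupport.sub (hasCompactSupport_cutoff_smul two_ne_zero)).mul_left
  -- Both cut-offs equal 1 on the ball of radius 1/2, so the singularity of `|ξ|^β` at the origin is
  -- never seen.
  have hsmooth : ContDiff ℝ ∞ f := by
    refine contDiff_iff_contDiffAt.2 fun ξ ↦ ?_
    by_cases hξ : ξ = 0
    · subst hξ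
      refine (contDiffAt_const (c := (0 : ℝ))).congr_of_eventuallyEq ?_
      filter_upwards [Metric.ball_mem_nhds (0 : Rn n) (ε := 1 / 2) (by norm_num)] with η hη
      rw [mem_ball_zero_iff] at hη
      simp only [hf]
      rw [cutoff_eq_one (by linarith), cutoff_eq_one (by rw [norm_smul]; norm_num; linarith)]
      simp
    · exact ((contDiffAt_norm ℝ hξ).rpow_const_of_ne (norm_ne_zero_iff.2 hξ)).mul hχ.contDiffAt
  exact ⟨HasCompactSupport.toSchwartzMap (f := fun ξ ↦ (f ξ : ℂ))
    (hsupp.comp_left (g := Complex.ofReal) Complex.ofReal_zero)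
    (Complex.ofRealCLM.contDiff.comp hsmooth), fun ξ ↦ rfl⟩

/-- Dyadic decomposition: the pieces `|ξ|^β (χ(2^j ξ) - χ(2^(j+1) ξ))` are dilates of one annulus
piece. Their inverse transforms have `L¹` norms proportional to `2^(-jβ)`, summable because `β > 0`.
-/
lemma exists_L1_fourier_eq_norm_rpow_mul_cutoff {β : ℝ} (hβ : 0 < β) :
    ∃ h : Lp ℂ 1 (volume : Measure (Rn n)), ∀ ξ,
      fourierEval ξ h = ((‖ξ‖ ^ β * cutoff n ξ : ℝ) : ℂ) := by
  obtain ⟨G, hG⟩ := exists_schwartz_annulus (n := n) β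
  set c : ℕ → ℝ := fun j ↦ (1 / 2 : ℝ) ^ j with hc
  have hc0 : ∀ j, 0 < c j := fun j ↦ by positivity
  set g : Rn n → ℂ := ((𝓕⁻ G : 𝓢(Rn n, ℂ)) : Rn n → ℂ) with hg
  have hgi : Integrable g := (𝓕⁻ G : 𝓢(Rn n, ℂ)).integrable
  have hFg : 𝓕 g = G := by rw [hg, ← SchwartzMap.fourier_coe]; simp
  have hint : ∀ j, Integrable fun x ↦ ((c j ^ β * c j ^ n : ℝ) : ℂ) * g (c j • x) := fun j ↦
    ((integrable_comp_smul_iff volume g (hc0 j).ne').2 hgi).const_mul _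
  let u : ℕ → Lp ℂ 1 (volume : Measure (Rn n)) := fun j ↦ (hint j).toL1
  have hFu : ∀ j ξ, fourierEval ξ (u j) = ((‖ξ‖ ^ β *
      (cutoff n ((2 : ℝ) ^ j • ξ) - cutoff n ((2 : ℝ) ^ (j + 1) • ξ)) : ℝ) : ℂ) := by
    intro j ξ
    have h2 : (c j)⁻¹ = 2 ^ j := by simp [hc]
    rw [fourierEval_toL1]
    have : (fun x ↦ ((c j ^ β * c j ^ n : ℝ) : ℂ) * g (c j • x))
      = ((c j ^ β * c j ^ n : ℝ) : ℂ) • fun x ↦ g (c j • x) := rfl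
    rw [this, show 𝓕 (((c j ^ β * c j ^ n : ℝ) : ℂ) • fun x ↦ g (c j • x)) ξ =
      ((c j ^ β * c j ^ n : ℝ) : ℂ) • 𝓕 (fun x ↦ g (c j • x)) ξ from congrFun
        (VectorFourier.fourierIntegral_const_smul _ _ _ _ _) ξ, fourier_comp_smul _ (hc0 j), hFg,
        hG,
      h2, norm_smul, Real.norm_of_nonneg (by positivity), smul_smul, ← pow_succ',
      Real.mul_rpow (by positivity) (norm_nonneg _), ← h2, Real.inv_rpow (hc0 j).le]
    have h3 : c j ^ β ≠ 0 := (Real.rpow_pos_of_pos (hc0 j) _).ne'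
    have h4 : c j ^ n ≠ 0 := pow_ne_zero _ (hc0 j).ne'
    rw [Complex.real_smul, smul_eq_mul, ← Complex.ofReal_mul, ← Complex.ofReal_mul]
    congr 1
    field_simp
  have hnorm : ∀ j, ‖u j‖ = ((1 / 2 : ℝ) ^ β) ^ j * ∫ x, ‖g x‖ := by
    intro j
    have h1 := Measure.integral_comp_smul (volume : Measure (Rn n)) (fun x ↦ ‖g x‖) (c j)
    rw [finrank_euclideanSpace_fin, abs_of_pos (inv_pos.2 (pow_pos (hc0 j) n))] at h1
    rw [L1.norm_of_fun_eq_integral_norm]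
    simp_rw [fun x ↦ norm_mul ((c j ^ β * c j ^ n : ℝ) : ℂ) (g (c j • x)), Complex.norm_real]
    rw [integral_const_mul, h1, Real.norm_of_nonneg
      (mul_pos (Real.rpow_pos_of_pos (hc0 j) _) (pow_pos (hc0 j) n)).le, smul_eq_mul,
      ← Real.rpow_natCast (_ ^ β), ← Real.rpow_mul (by norm_num), mul_comm β, Real.rpow_mul
      (by norm_num), Real.rpow_natCast]
    have h4 : c j ^ n ≠ 0 := pow_ne_zero _ (hc0 j).ne'
    change c j ^ β * c j ^ n * _ = c j ^ β * _
    field_simp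
  have hsum : Summable u := by
    refine Summable.of_norm ?_
    simp only [hnorm]
    refine (summable_geometric_of_lt_one (by positivity) ?_).mul_right _
    exact Real.rpow_lt_one (by norm_num) (by norm_num) hβ
  refine ⟨∑' j, u j, fun ξ ↦ ?_⟩
  have h1 := (hsum.hasSum.mapL (fourierEval ξ)).tendsto_sum_nat
  refine tendsto_nhds_unique h1 ?_
  have h2 : ∀ N, ∑ j ∈ Finset.range N, fourierEval ξ (u j) =
      ((‖ξ‖ ^ β * (cutoff n ξ - cutoff n ((2 : ℝ) ^ N • ξ)) : ℝ) : ℂ) := by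
    intro N
    simp only [hFu]
    rw [← Complex.ofReal_sum, ← Finset.mul_sum,
      Finset.sum_range_sub' (fun j ↦ cutoff n ((2 : ℝ) ^ j • ξ)), pow_zero, one_smul]
  simp only [h2]
  refine tendsto_const_nhds.congr' ?_
  -- The telescoped remainder `|ξ|^β χ(2^N ξ)` vanishes for large `N` if `ξ ≠ 0`, and for every `N`
  -- at the origin because `0^β = 0`.
  by_cases hξ : ξ = 0
  · filter_upwards with N
    simp [hξ, Real.zero_rpow hβ.ne']
  · obtain ⟨N, hN⟩ := pow_unbounded_of_one_lt (2 / ‖ξ‖) (one_lt_two (α := ℝ))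
    filter_upwards [eventually_ge_atTop N] with m hm
    rw [cutoff_eq_zero (ξ := (2 : ℝ) ^ m • ξ), sub_zero]
    rw [norm_smul, Real.norm_of_nonneg (by positivity)]
    rw [div_lt_iff₀ (norm_pos_iff.2 hξ)] at hN
    refine hN.le.trans ?_
    gcongr
    exact one_le_two

lemma continuous_symbol {β : ℝ} (hβ : 0 < β) (t : ℝ) : Continuous (symbol (n := n) β t) := by
  unfold symbol
  have : Continuous fun ξ : Rn n ↦ ‖ξ‖ ^ β := continuous_norm.rpow_const fun _ ↦ Or.inr hβ.le
  fun_prop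

/-- If `h` has transform `|ξ|^β χ(ξ)`, then `exp(-t h*)`, an exponential of a bounded operator on
`L¹`, multiplies transforms by `exp(-t|ξ|^β χ(ξ))`. Applied to the inverse transform of `χ(2ξ)` it
produces the low frequencies, since `χ = 1` wherever `χ(2ξ) ≠ 0`; the Schwartz part supplies the
rest. -/
lemma exists_fourier_eq_symbol {β t : ℝ} (hβ : 0 < β) (ht : 0 < t) :
    ∃ W : Rn n → ℂ, Integrable W ∧ 𝓕 W = symbol β t := by
  obtain ⟨φ, hφ⟩ := exists_schwartz_high_frequency (n := n) hβ ht
  obtain ⟨h, hh⟩ := exists_L1_fourier_eq_norm_rpow_mul_cutoff (n := n) hβ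
  let θ : 𝓢(Rn n, ℂ) := HasCompactSupport.toSchwartzMap
    (f := fun ξ ↦ (cutoff n ((2 : ℝ) • ξ) : ℂ))
    ((hasCompactSupport_cutoff_smul two_ne_zero).comp_left (g := Complex.ofReal)
      Complex.ofReal_zero) (Complex.ofRealCLM.contDiff.comp (contDiff_cutoff_smul 2))
  have hF : ∀ ψ : 𝓢(Rn n, ℂ), 𝓕 ((𝓕⁻ ψ : 𝓢(Rn n, ℂ)) : Rn n → ℂ) = ψ := fun ψ ↦ by
    rw [← SchwartzMap.fourier_coe]; simp
  let A := Lp ℂ 1 (volume : Measure (Rn n))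
  let w : A := NormedSpace.exp (-(t : ℂ) • convL1 h) (𝓕⁻ θ : 𝓢(Rn n, ℂ)).integrable.toL1 +
    (𝓕⁻ φ : 𝓢(Rn n, ℂ)).integrable.toL1
  refine ⟨w, L1.integrable_coeFn w, funext fun ξ ↦ ?_⟩
  rw [← fourierEval_apply]
  have h1 : ∀ u, fourierEval ξ ((-(t : ℂ) • convL1 h) u) =
      (-t * (‖ξ‖ ^ β * cutoff n ξ : ℝ) : ℂ) * fourierEval ξ u := by
    intro u
    rw [smul_apply, map_smul, fourierEval_apply, fourier_convL1, ← fourierEval_apply,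
      ← fourierEval_apply, hh, smul_eq_mul, mul_assoc]
  rw [map_add, apply_exp_of_forall_apply_eq _ _ _ h1, fourierEval_toL1, fourierEval_toL1, hF,
    hF, hφ]
  change _ * (cutoff n ((2 : ℝ) • ξ) : ℂ) + _ = _
  rcases le_or_gt ‖ξ‖ 1 with h | h
  · rw [cutoff_eq_one h, symbol]
    push_cast
    ring_nf
  · rw [cutoff_eq_zero (ξ := (2 : ℝ) • ξ) (by rw [norm_smul]; norm_num; linarith)]
    simp

lemma integrable_symbol {β t : ℝ} (hβ : 0 < β) (ht : 0 < t) :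
    Integrable (symbol (n := n) β t) := by
  obtain ⟨φ, hφ⟩ := exists_schwartz_high_frequency (n := n) hβ ht
  have h : symbol (n := n) β t =
      (fun ξ ↦ (cutoff n ((2 : ℝ) • ξ) : ℂ) * symbol β t ξ) + φ := by
    ext ξ
    rw [Pi.add_apply, hφ]
    ring
  rw [h]
  refine Integrable.add (Continuous.integrable_of_hasCompactSupport ?_ ?_) φ.integrable
  · exact (Complex.continuous_ofReal.comp (contDiff_cutoff_smul 2).continuous).mul
      (continuous_symbol hβ t)
  · exact HasCompactSupport.mul_right ((hasCompactSupport_cutoff_smul two_ne_zero).comp_left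
      (g := Complex.ofReal) Complex.ofReal_zero)

/-- The inverse Fourier transform of the symbol is real. -/
lemma ofReal_kernel (β t : ℝ) (x : Rn n) : (kernel β t x : ℂ) = 𝓕⁻ (symbol β t) x := by
  refine Complex.conj_eq_iff_re.1 ?_
  rw [Real.fourierInv_eq, ← integral_conj, ← integral_neg_eq_self]
  refine integral_congr_ae (.of_forall fun ξ ↦ ?_)
  beta_reduce
  rw [norm_neg, Circle.smul_def, Circle.smul_def, smul_eq_mul, smul_eq_mul, map_mul]
  congr 1
  · rw [inner_neg_left, ← Circle.coe_inv_eq_conj, AddChar.map_neg_eq_inv, inv_inv]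
  · exact Complex.conj_ofReal _

lemma integrable_fourierInv_symbol {β t : ℝ} (hβ : 0 < β) (ht : 0 < t) :
    Integrable (𝓕⁻ (symbol (n := n) β t)) := by
  obtain ⟨W, hW, hFW⟩ := exists_fourier_eq_symbol (n := n) hβ ht
  have := ae_eq_fourierInv_fourier hW (hFW ▸ integrable_symbol hβ ht)
  rw [hFW] at this
  exact hW.congr this

lemma integrable_kernel {β t : ℝ} (hβ : 0 < β) (ht : 0 < t) :
    Integrable (kernel (n := n) β t) :=
  (integrable_fourierInv_symbol hβ ht).re

lemma fourier_kernel {β t : ℝ} (hβ : 0 < β) (ht : 0 < t) :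
    𝓕 (fun x : Rn n ↦ (kernel β t x : ℂ)) = symbol β t := by
  simp only [ofReal_kernel]
  refine (continuous_symbol hβ t).fourier_fourierInv_eq (integrable_symbol hβ ht) ?_
  have := (integrable_fourierInv_symbol (n := n) hβ ht).comp_neg
  refine this.congr (.of_forall fun x ↦ ?_)
  beta_reduce
  rw [Real.fourierInv_eq_fourier_neg, neg_neg]

lemma continuous_kernel {β t : ℝ} (hβ : 0 < β) (ht : 0 < t) :
    Continuous (kernel (n := n) β t) := by
  have := VectorFourier.fourierIntegral_continuous (L := innerₗ (Rn n)) (μ := volume)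
    Real.continuous_fourierChar (innerSL ℝ).continuous₂ (integrable_symbol (n := n) hβ ht)
  have h2 : 𝓕⁻ (symbol (n := n) β t) = fun x ↦ 𝓕 (symbol β t) (-x) := by
    ext x; rw [Real.fourierInv_eq_fourier_neg]
  exact Complex.continuous_re.comp (by
    change Continuous (𝓕⁻ (symbol (n := n) β t))
    rw [h2]; exact this.comp continuous_neg)

/-- The semigroup property `K_β(s) * K_β(t) = K_β(s + t)`. -/
lemma convolution_kernel {β s t : ℝ} (hβ : 0 < β) (hs : 0 < s) (ht : 0 < t) :
    convolution (kernel (n := n) β s) (kernel β t) (mul ℝ ℝ) volume =ᵐ[volume]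
      kernel β (s + t) := by
  have hs' : Integrable (fun x : Rn n ↦ (kernel β s x : ℂ)) :=
    (integrable_kernel hβ hs).ofReal
  have ht' : Integrable (fun x : Rn n ↦ (kernel β t x : ℂ)) :=
    (integrable_kernel hβ ht).ofReal
  have hF : 𝓕 (convolution (fun x : Rn n ↦ (kernel β s x : ℂ)) (fun x ↦ (kernel β t x : ℂ))
      (mul ℂ ℂ) volume) = symbol β (s + t) := by
    ext ξ
    rw [Real.fourier_mul_convolution_eq hs' ht', fourier_kernel hβ hs, fourier_kernel hβ ht, symbol,
      symbol, symbol, ← Complex.ofReal_mul, ← Real.exp_add, neg_add, add_mul]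
  have := ae_eq_fourierInv_fourier (hs'.integrable_convolution (mul ℂ ℂ) ht')
    (hF ▸ integrable_symbol hβ (add_pos hs ht))
  rw [hF] at this
  filter_upwards [this] with x hx
  rw [← ofReal_kernel] at hx
  rw [← Complex.ofReal_inj, ← hx, convolution, convolution, ← integral_complex_ofReal]
  simp

/-- The scaling of the kernel: `K_β(l^β t, x) = l⁻ⁿ K_β(t, l⁻¹ x)`. -/
lemma kernel_scaling (β t : ℝ) {l : ℝ} (hl : 0 < l) (x : Rn n) :
    kernel β (l ^ β * t) x = (l ^ n)⁻¹ * kernel β t (l⁻¹ • x) := by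
  have h : symbol (n := n) β (l ^ β * t) = fun ξ ↦ symbol β t (l • ξ) := by
    ext ξ
    rw [symbol, symbol, norm_smul, Real.norm_of_nonneg hl.le, Real.mul_rpow hl.le (norm_nonneg _)]
    congr 2
    ring
  rw [← Complex.ofReal_inj, Complex.ofReal_mul, ofReal_kernel, ofReal_kernel,
    Real.fourierInv_eq_fourier_neg, Real.fourierInv_eq_fourier_neg, ← smul_neg,
    ← Complex.real_smul, h, fourier_comp_smul _ hl]

end Kernel

/-! ### Continuity of the kernel in `L¹` -/

section KernelContinuity

open Filter Topology

variable {n : ℕ}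

/-- Scheffé's lemma: pointwise convergence together with convergence of the `L¹` norms implies
convergence in `L¹`. -/
lemma tendsto_integral_norm_sub_zero {X ι G : Type*} [MeasurableSpace X] {μ : Measure X}
    [NormedAddCommGroup G] {l : Filter ι} [l.IsCountablyGenerated] {f : ι → X → G} {g : X → G}
    (hf : ∀ᶠ i in l, Integrable (f i) μ) (hg : Integrable g μ)
    (hlim : ∀ᵐ x ∂μ, Tendsto (fun i ↦ f i x) l (𝓝 (g x)))
    (hnorm : Tendsto (fun i ↦ ∫ x, ‖f i x‖ ∂μ) l (𝓝 (∫ x, ‖g x‖ ∂μ))) :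
    Tendsto (fun i ↦ ∫ x, ‖f i x - g x‖ ∂μ) l (𝓝 0) := by
  have h1 : Tendsto (fun i ↦ ∫ x, (‖f i x‖ + ‖g x‖ - ‖f i x - g x‖) ∂μ) l
      (𝓝 (∫ x, 2 * ‖g x‖ ∂μ)) := by
    refine tendsto_integral_filter_of_dominated_convergence (fun x ↦ 2 * ‖g x‖) ?_ ?_
      (hg.norm.const_mul 2) ?_
    · filter_upwards [hf] with i hi
      exact ((hi.norm.add hg.norm).sub (hi.sub hg).norm).aestronglyMeasurable
    · filter_upwards with i
      filter_upwards with x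
      rw [Real.norm_of_nonneg (by linarith [norm_sub_le (f i x) (g x)])]
      have := norm_sub_norm_le (f i x) (g x)
      linarith
    · filter_upwards [hlim] with x hx
      have := (hx.norm.add_const ‖g x‖).sub (hx.sub_const (g x)).norm
      simpa [two_mul] using this
  have h2 := (hnorm.add_const (∫ x, ‖g x‖ ∂μ)).sub h1
  rw [integral_const_mul, two_mul, sub_self] at h2
  refine h2.congr' ?_
  filter_upwards [hf] with i hi
  have h3 : Integrable (fun x ↦ ‖f i x‖ + ‖g x‖) μ := hi.norm.add hg.norm
  have h4 : Integrable (fun x ↦ ‖f i x‖ + ‖g x‖ - ‖f i x - g x‖) μ := h3.sub (hi.sub hg).norm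
  rw [← integral_add hi.norm hg.norm, ← integral_sub h3 h4]
  simp

lemma kernel_eq_scaling {β t : ℝ} (hβ : 0 < β) (ht : 0 < t) (x : Rn n) :
    kernel β t x = ((t ^ (1 / β)) ^ n)⁻¹ * kernel β 1 ((t ^ (1 / β))⁻¹ • x) := by
  rw [← kernel_scaling β 1 (by positivity), ← Real.rpow_mul ht.le, one_div_mul_cancel hβ.ne',
    Real.rpow_one, mul_one]

lemma integral_norm_kernel {β t : ℝ} (hβ : 0 < β) (ht : 0 < t) :
    ∫ x : Rn n, ‖kernel β t x‖ = ∫ x : Rn n, ‖kernel β 1 x‖ := by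
  have hl : 0 < t ^ (1 / β) := by positivity
  have h := Measure.integral_comp_smul (volume : Measure (Rn n)) (fun x ↦ ‖kernel β 1 x‖)
    (t ^ (1 / β))⁻¹
  rw [finrank_euclideanSpace_fin, abs_of_pos (by positivity), inv_pow, inv_inv] at h
  simp only [kernel_eq_scaling hβ ht, norm_mul]
  rw [integral_const_mul, h, Real.norm_of_nonneg (by positivity), smul_eq_mul,
    inv_mul_cancel_left₀ (by positivity)]

/-- The kernel as an element of `L¹`. -/
def kernelL1 (n : ℕ) (β t : ℝ) : Lp ℝ 1 (volume : Measure (Rn n)) :=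
  open Classical in if h : Integrable (kernel β t) then h.toL1 else 0

lemma coeFn_kernelL1 {β t : ℝ} (hβ : 0 < β) (ht : 0 < t) :
    kernelL1 n β t =ᵐ[volume] kernel β t := by
  rw [kernelL1, dif_pos (integrable_kernel hβ ht)]
  exact Integrable.coeFn_toL1 _

/-- Scaling makes the `L¹` norm independent of time and the kernel pointwise continuous in time, so
Scheffé's lemma applies. -/
lemma continuousOn_kernelL1 {β : ℝ} (hβ : 0 < β) : ContinuousOn (kernelL1 n β) (Ioi 0) := by
  intro t ht
  rw [mem_Ioi] at ht
  refine ContinuousAt.continuousWithinAt ?_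
  rw [ContinuousAt, tendsto_iff_norm_sub_tendsto_zero]
  have hpos : ∀ᶠ s in 𝓝 t, 0 < s := eventually_gt_nhds ht
  have key : Tendsto (fun s ↦ ∫ x : Rn n, ‖kernel β s x - kernel β t x‖) (𝓝 t) (𝓝 0) := by
    refine tendsto_integral_norm_sub_zero ?_ (integrable_kernel hβ ht) (.of_forall fun x ↦ ?_) ?_
    · filter_upwards [hpos] with s hs using integrable_kernel hβ hs
    · have hc : ContinuousAt (fun s : ℝ ↦ s ^ (1 / β)) t :=
        Real.continuousAt_rpow_const _ _ (Or.inl ht.ne')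
      have hl : (t ^ (1 / β)) ≠ 0 := by positivity
      have h2 : ContinuousAt (fun s : ℝ ↦
          ((s ^ (1 / β)) ^ n)⁻¹ * kernel β 1 ((s ^ (1 / β))⁻¹ • x)) t := by
        refine ((hc.pow n).inv₀ (pow_ne_zero _ hl)).mul ?_
        exact (continuous_kernel hβ one_pos).continuousAt.comp
          ((hc.inv₀ hl).smul continuousAt_const)
      rw [kernel_eq_scaling hβ ht x]
      refine h2.tendsto.congr' ?_
      filter_upwards [hpos] with s hs using (kernel_eq_scaling hβ hs x).symm
    · refine tendsto_const_nhds.congr' ?_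
      filter_upwards [hpos] with s hs
      rw [integral_norm_kernel hβ hs, integral_norm_kernel hβ ht]
  refine key.congr' ?_
  filter_upwards [hpos] with s hs
  rw [L1.norm_eq_integral_norm]
  refine integral_congr_ae ?_
  filter_upwards [Lp.coeFn_sub (kernelL1 n β s) (kernelL1 n β t), coeFn_kernelL1 (n := n) hβ hs,
    coeFn_kernelL1 (n := n) hβ ht] with x h1 h2 h3
  rw [h1, Pi.sub_apply, h2, h3]

end KernelContinuity

/-! ### Continuity of translations on Schwartz functions -/

section Translation

open Filter Topology

variable {𝕜 : Type*} [RCLike 𝕜] {n : ℕ}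

lemma translate_apply (y : Rn n) (f : Tempered 𝕜 n) (φ : 𝓢(Rn n, 𝕜)) :
    translate y f φ = f (SchwartzMap.compSubConstCLM 𝕜 (-y) φ) := rfl

lemma translate_translate (y z : Rn n) (f : Tempered 𝕜 n) :
    translate y (translate z f) = translate (y + z) f := by
  ext φ
  rw [translate_apply, translate_apply, translate_apply, SchwartzMap.compSubConstCLM_comp, neg_add]

/-- Translation of a Schwartz function is continuous in the translation parameter. -/
lemma continuous_compSubConst (φ : 𝓢(Rn n, 𝕜)) :
    Continuous fun y : Rn n ↦ SchwartzMap.compSubConstCLM 𝕜 (-y) φ := by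
  have hd : ∀ (l : ℕ) (y x : Rn n), iteratedFDeriv ℝ l (SchwartzMap.compSubConstCLM 𝕜 (-y) φ) x
      = iteratedFDeriv ℝ l φ (x + y) := by
    intro l y x
    have h : ⇑(SchwartzMap.compSubConstCLM 𝕜 (-y) φ) = fun x ↦ φ (x + y) := by
      ext x; rw [SchwartzMap.compSubConstCLM_apply, sub_neg_eq_add]
    rw [h, iteratedFDeriv_comp_add_right]
  refine continuous_iff_continuousAt.2 fun y₀ ↦ ?_
  rw [ContinuousAt, (schwartz_withSeminorms 𝕜 (Rn n) 𝕜).tendsto_nhds]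
  rintro ⟨k, l⟩ ε hε
  set S : ℝ := 2 ^ k * ((Finset.Iic (k, l + 1)).sup fun m ↦ SchwartzMap.seminorm 𝕜 m.1 m.2) φ
    with hS
  have hS0 : 0 ≤ S := by positivity
  set D : ℝ := (2 + ‖y₀‖) ^ k * S with hD
  have hD0 : 0 ≤ D := by positivity
  -- Mean value inequality in the translation parameter: one more derivative of `φ` is spent, and
  -- its decay at `x + z` is traded for decay at `x` since `|z| ≤ 1 + |y₀|`.
  have hbound : ∀ y ∈ Metric.ball y₀ 1, ∀ x : Rn n,
      ‖x‖ ^ k * ‖iteratedFDeriv ℝ l φ (x + y) - iteratedFDeriv ℝ l φ (x + y₀)‖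
        ≤ D * ‖y - y₀‖ := by
    intro y hy x
    have hder : ∀ z ∈ Metric.ball y₀ 1, HasFDerivWithinAt (fun z ↦ iteratedFDeriv ℝ l φ (x + z))
        (fderiv ℝ (iteratedFDeriv ℝ l φ) (x + z)) (Metric.ball y₀ 1) z := by
      intro z _
      have h1 : DifferentiableAt ℝ (iteratedFDeriv ℝ l φ) (x + z) :=
        ((φ.smooth ⊤).differentiable_iteratedFDeriv (m := l)
          (by exact_mod_cast WithTop.coe_lt_top _)).differentiableAt
      exact ((hasFDerivAt_comp_add_left x).2 h1.hasFDerivAt).hasFDerivWithinAt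
    have hle : ∀ z ∈ Metric.ball y₀ 1, ‖fderiv ℝ (iteratedFDeriv ℝ l φ) (x + z)‖ ≤
        D / (1 + ‖x‖) ^ k := by
      intro z hz
      rw [norm_fderiv_iteratedFDeriv, le_div_iff₀ (by positivity)]
      have h1 := SchwartzMap.one_add_le_sup_seminorm_apply (𝕜 := 𝕜) (m := (k, l + 1))
        (k := k) (n := l + 1) le_rfl le_rfl φ (x + z)
      have h2 : 1 + ‖x‖ ≤ (2 + ‖y₀‖) * (1 + ‖x + z‖) := by
        have h3 : ‖z‖ ≤ 1 + ‖y₀‖ := by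
          rw [mem_ball_iff_norm] at hz
          linarith [norm_le_insert' z y₀]
        have h4 : ‖x‖ ≤ ‖x + z‖ + ‖z‖ := by
          simpa using norm_sub_le (x + z) z
        nlinarith [norm_nonneg (x + z), norm_nonneg y₀]
      calc ‖iteratedFDeriv ℝ (l + 1) φ (x + z)‖ * (1 + ‖x‖) ^ k
          ≤ ‖iteratedFDeriv ℝ (l + 1) φ (x + z)‖ * ((2 + ‖y₀‖) * (1 + ‖x + z‖)) ^ k := by gcongr
        _ = (2 + ‖y₀‖) ^ k *
            ((1 + ‖x + z‖) ^ k * ‖iteratedFDeriv ℝ (l + 1) φ (x + z)‖) := by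
          rw [mul_pow]; ring
        _ ≤ D := by rw [hD]; gcongr
    have h5 := (convex_ball y₀ 1).norm_image_sub_le_of_norm_hasFDerivWithin_le hder hle
      (Metric.mem_ball_self one_pos) hy
    calc ‖x‖ ^ k * ‖iteratedFDeriv ℝ l φ (x + y) - iteratedFDeriv ℝ l φ (x + y₀)‖
        ≤ (1 + ‖x‖) ^ k * (D / (1 + ‖x‖) ^ k * ‖y - y₀‖) := by
          gcongr
          linarith
      _ = D * ‖y - y₀‖ := by field_simp
  have hev : ∀ᶠ y in 𝓝 y₀, D * ‖y - y₀‖ < ε := by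
    have : Tendsto (fun y ↦ D * ‖y - y₀‖) (𝓝 y₀) (𝓝 (D * ‖y₀ - y₀‖)) := by
      have : Continuous fun y ↦ D * ‖y - y₀‖ := by fun_prop
      exact this.tendsto y₀
    rw [sub_self, norm_zero, mul_zero] at this
    exact this.eventually (eventually_lt_nhds hε)
  filter_upwards [hev, Metric.ball_mem_nhds y₀ one_pos] with y hy hy1
  refine lt_of_le_of_lt ?_ hy
  refine SchwartzMap.seminorm_le_bound 𝕜 k l _ (by positivity) fun x ↦ ?_
  have hcoe : ∀ ψ₁ ψ₂ : 𝓢(Rn n, 𝕜), ⇑(ψ₁ - ψ₂) = ⇑ψ₁ - ⇑ψ₂ := fun _ _ ↦ rfl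
  rw [hcoe, iteratedFDeriv_sub_apply, hd, hd]
  · exact hbound y hy1 x
  · exact SchwartzMap.contDiffAt _ l
  · exact SchwartzMap.contDiffAt _ l

lemma continuous_translate_apply (f : Tempered 𝕜 n) (φ : 𝓢(Rn n, 𝕜)) :
    Continuous fun y ↦ translate y f φ :=
  (map_continuous f).comp (continuous_compSubConst φ)

end Translation

/-! ### Convolution with bounded distributions: linearity, semigroup law, scaling -/

section Evolution

open Filter Topology ContinuousLinearMap

variable {𝕜 : Type*} [RCLike 𝕜] {n : ℕ}

lemma translate_sub (y : Rn n) (f g : Tempered 𝕜 n) :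
    translate y (f - g) = translate y f - translate y g := rfl

lemma translate_smul (y : Rn n) (c : 𝕜) (f : Tempered 𝕜 n) :
    translate y (c • f) = c • translate y f := rfl

lemma IsBoundedDistribution.add {f g : Tempered 𝕜 n} (hf : IsBoundedDistribution f)
    (hg : IsBoundedDistribution g) : IsBoundedDistribution (f + g) := by
  intro φ
  obtain ⟨C, hC⟩ := hf φ
  obtain ⟨D, hD⟩ := hg φ
  exact ⟨C + D, fun y ↦ (norm_add_le _ _).trans (add_le_add (hC y) (hD y))⟩

lemma IsBoundedDistribution.smul {f : Tempered 𝕜 n} (hf : IsBoundedDistribution f) (c : 𝕜) :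
    IsBoundedDistribution (c • f) := by
  intro φ
  obtain ⟨C, hC⟩ := hf φ
  refine ⟨‖c‖ * C, fun y ↦ ?_⟩
  rw [translate_smul]
  exact (norm_smul_le c (translate y f φ)).trans (by gcongr; exact hC y)

lemma IsBoundedDistribution.integrable {f : Tempered 𝕜 n} (hf : IsBoundedDistribution f)
    {k : Rn n → ℝ} (hk : Integrable k) (φ : 𝓢(Rn n, 𝕜)) :
    Integrable fun y ↦ k y • translate y f φ := by
  obtain ⟨C, hC⟩ := hf φ
  exact hk.smul_bdd C (continuous_translate_apply f φ).aestronglyMeasurable (.of_forall hC)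

lemma IsConvolution.unique {k : Rn n → ℝ} {f g g' : Tempered 𝕜 n} (h : IsConvolution k f g)
    (h' : IsConvolution k f g') : g = g' := by
  ext φ
  rw [h φ, h' φ]

lemma IsConvolution.congr_ae {k k' : Rn n → ℝ} (hk : k =ᵐ[volume] k') {f g : Tempered 𝕜 n}
    (h : IsConvolution k f g) : IsConvolution k' f g := by
  intro φ
  rw [h φ]
  refine integral_congr_ae ?_
  filter_upwards [hk] with y hy
  rw [hy]

lemma IsConvolution.add {k : Rn n → ℝ} (hk : Integrable k) {f f' g g' : Tempered 𝕜 n}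
    (hf : IsBoundedDistribution f) (hf' : IsBoundedDistribution f')
    (h : IsConvolution k f g) (h' : IsConvolution k f' g') :
    IsConvolution k (f + f') (g + g') := by
  intro φ
  change g φ + g' φ = ∫ y, k y • (translate y f φ + translate y f' φ)
  simp_rw [smul_add]
  rw [integral_add (hf.integrable hk φ) (hf'.integrable hk φ), h φ, h' φ]

lemma IsConvolution.smul {k : Rn n → ℝ} {f g : Tempered 𝕜 n} (h : IsConvolution k f g) (c : 𝕜) :
    IsConvolution k (c • f) (c • g) := by
  intro φ
  change c • g φ = ∫ y, k y • (c • translate y f φ)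
  simp_rw [smul_comm _ c]
  rw [integral_smul, h φ]

lemma IsConvolution.add_kernel {k k' : Rn n → ℝ} (hk : Integrable k) (hk' : Integrable k')
    {f g g' : Tempered 𝕜 n} (hf : IsBoundedDistribution f)
    (h : IsConvolution k f g) (h' : IsConvolution k' f g') :
    IsConvolution (k + k') f (g + g') := by
  intro φ
  change g φ + g' φ = ∫ y, (k y + k' y) • translate y f φ
  simp_rw [add_smul]
  rw [integral_add (hf.integrable hk φ) (hf.integrable hk' φ), h φ, h' φ]

lemma IsConvolution.smul_kernel {k : Rn n → ℝ} {f g : Tempered 𝕜 n} (h : IsConvolution k f g)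
    (c : ℝ) : IsConvolution (c • k) f ((c : 𝕜) • g) := by
  intro φ
  change (c : 𝕜) • g φ = ∫ y, (c * k y) • translate y f φ
  simp_rw [mul_smul]
  rw [integral_smul, h φ, RCLike.real_smul_eq_coe_smul (K := 𝕜)]

lemma IsEvolution.unique {β t : ℝ} {f g g' : Tempered 𝕜 n} (h : IsEvolution β t f g)
    (h' : IsEvolution β t f g') : g = g' :=
  h.2.unique h'.2

lemma IsEvolution.add {β t : ℝ} (hβ : 0 < β) (ht : 0 < t) {f f' g g' : Tempered 𝕜 n}
    (h : IsEvolution β t f g) (h' : IsEvolution β t f' g') :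
    IsEvolution β t (f + f') (g + g') :=
  ⟨h.1.add h'.1, h.2.add (integrable_kernel hβ ht) h.1 h'.1 h'.2⟩

lemma IsEvolution.smul {β t : ℝ} {f g : Tempered 𝕜 n} (h : IsEvolution β t f g) (c : 𝕜) :
    IsEvolution β t (c • f) (c • g) :=
  ⟨h.1.smul c, h.2.smul c⟩

lemma IsEvolution.sub {β t : ℝ} (hβ : 0 < β) (ht : 0 < t) {f f' g g' : Tempered 𝕜 n}
    (h : IsEvolution β t f g) (h' : IsEvolution β t f' g') :
    IsEvolution β t (f - f') (g - g') := by
  have e : ∀ u v : Tempered 𝕜 n, u - v = u + (-1 : 𝕜) • v := by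
    intro u v
    ext φ
    change u φ - v φ = u φ + (-1 : 𝕜) * v φ
    ring
  rw [e, e]
  exact h.add hβ ht (h'.smul (-1))

/-- Fubini and the substitution `x = z + y`; boundedness of `F` gives integrability on the product.
This is associativity of convolution in the form needed for the semigroup law. -/
lemma integral_smul_integral_smul_comp_add {k₁ k₂ : Rn n → ℝ} (h₁ : Integrable k₁)
    (h₂ : Integrable k₂) {F : Rn n → 𝕜} (hF : Continuous F) {C : ℝ} (hC : ∀ y, ‖F y‖ ≤ C) :
    ∫ z, k₁ z • ∫ y, k₂ y • F (z + y) = ∫ x, convolution k₁ k₂ (mul ℝ ℝ) volume x • F x := by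
  have hint : Integrable (fun p : Rn n × Rn n ↦ (k₁ p.2 * k₂ (p.1 - p.2)) • F p.1)
      (volume.prod volume) :=
    (h₁.convolution_integrand (mul ℝ ℝ) h₂).smul_bdd C
      (hF.comp continuous_fst).aestronglyMeasurable (.of_forall fun p ↦ hC p.1)
  have h3 : ∀ x, convolution k₁ k₂ (mul ℝ ℝ) volume x • F x =
      ∫ z, (k₁ z * k₂ (x - z)) • F x := fun x ↦ (integral_smul_const _ _).symm
  simp_rw [h3]
  rw [integral_integral_swap hint]
  congr 1 with z
  rw [← integral_smul, ← integral_add_right_eq_self (fun x ↦ (k₁ z * k₂ (x - z)) • F x) z]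
  congr 1 with y
  rw [add_sub_cancel_right, mul_smul, add_comm]

lemma IsConvolution.translate_apply_eq {k : Rn n → ℝ} {f g : Tempered 𝕜 n}
    (h : IsConvolution k f g) (z : Rn n) (φ : 𝓢(Rn n, 𝕜)) :
    translate z g φ = ∫ y, k y • translate (z + y) f φ := by
  rw [translate_apply, h]
  congr 1 with y
  rw [← translate_translate]
  rfl

/-- The semigroup property `S_β(s) S_β(t) f = S_β(s + t) f`. -/
lemma IsEvolution.trans {β s t : ℝ} (hβ : 0 < β) (hs : 0 < s) (ht : 0 < t)
    {f g h : Tempered 𝕜 n} (hg : IsEvolution β t f g) (hh : IsEvolution β s g h) :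
    IsEvolution β (s + t) f h := by
  refine ⟨hg.1, fun φ ↦ ?_⟩
  obtain ⟨C, hC⟩ := hg.1 φ
  rw [hh.2 φ]
  simp_rw [hg.2.translate_apply_eq]
  rw [integral_smul_integral_smul_comp_add (integrable_kernel hβ hs) (integrable_kernel hβ ht)
    (continuous_translate_apply f φ) hC]
  refine integral_congr_ae ?_
  filter_upwards [convolution_kernel (n := n) hβ hs ht] with x hx
  rw [hx]

/-- The test function is `φ(l ·)`, written with `l⁻¹⁻¹` because it arises from unfolding the
dilation by `l⁻¹`. -/
lemma translate_dilate_inv {l : ℝ} (hl : 0 < l) (f : Tempered 𝕜 n) (y : Rn n)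
    (φ : 𝓢(Rn n, 𝕜)) :
    translate y (dilate l hl f) (SchwartzMap.compCLMOfContinuousLinearEquiv 𝕜
      (ContinuousLinearEquiv.smulLeft (M₁ := Rn n) (R₁ := ℝ)
        (Units.mk0 l⁻¹⁻¹ (inv_ne_zero (inv_pos.2 hl).ne'))) φ) =
      (((l ^ n)⁻¹ : ℝ) : 𝕜) • translate (l • y) f φ := by
  change (((l ^ n)⁻¹ : ℝ) : 𝕜) • f _ = (((l ^ n)⁻¹ : ℝ) : 𝕜) • f _
  congr 2
  ext x
  change φ (l⁻¹⁻¹ • (l⁻¹ • x - -y)) = φ (x - -(l • y))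
  rw [inv_inv, smul_sub, smul_inv_smul₀ hl.ne', smul_neg]

/-- The scaling of the evolution: `S_β(l^β t) f = (S_β(t) f_l)_{1/l}`. -/
lemma IsEvolution.of_dilate {β t l : ℝ} (hl : 0 < l) {f g : Tempered 𝕜 n}
    (h : IsEvolution β t (dilate l hl f) g) :
    IsEvolution β (l ^ β * t) f (dilate l⁻¹ (inv_pos.2 hl) g) := by
  refine ⟨fun φ ↦ ?_, fun φ ↦ ?_⟩
  · obtain ⟨C, hC⟩ := h.1 (SchwartzMap.compCLMOfContinuousLinearEquiv 𝕜
      (ContinuousLinearEquiv.smulLeft (M₁ := Rn n) (R₁ := ℝ)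
        (Units.mk0 l⁻¹⁻¹ (inv_ne_zero (inv_pos.2 hl).ne'))) φ)
    refine ⟨l ^ n * C, fun y ↦ ?_⟩
    have h1 := hC (l⁻¹ • y)
    rw [translate_dilate_inv, smul_inv_smul₀ hl.ne', norm_smul, RCLike.norm_ofReal,
      abs_of_pos (by positivity), inv_mul_le_iff₀ (by positivity)] at h1
    exact h1
  · change (((l⁻¹ ^ n)⁻¹ : ℝ) : 𝕜) • g _ = _
    rw [h.2, inv_pow, inv_inv, ← RCLike.real_smul_eq_coe_smul]
    have h1 := Measure.integral_comp_smul (volume : Measure (Rn n))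
      (fun x ↦ kernel β (l ^ β * t) x • translate x f φ) l
    have h2 : l ^ n ≠ 0 := by positivity
    rw [finrank_euclideanSpace_fin, abs_of_pos (by positivity), eq_inv_smul_iff₀ h2] at h1
    rw [← h1]
    congr 1
    refine integral_congr_ae (.of_forall fun y ↦ ?_)
    beta_reduce
    refine (congrArg (kernel β t y • ·) (translate_dilate_inv hl f y φ)).trans ?_
    beta_reduce
    rw [kernel_scaling β t hl, inv_smul_smul₀ hl.ne',
      ← RCLike.real_smul_eq_coe_smul, smul_smul, mul_comm]

end Evolution

/-! ### Convolution and evolution as bounded operators on `E` -/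

section SpaceEvolution

open Filter Topology ContinuousLinearMap

variable {𝕜 : Type*} [RCLike 𝕜] {n : ℕ} {E : Type*} [NormedAddCommGroup E] [NormedSpace 𝕜 E]
  {ι : E →L[𝕜] Tempered 𝕜 n}

/-- The pairing with a test function as a continuous functional on `E`. -/
def pairingCLM (ι : E →L[𝕜] Tempered 𝕜 n) (φ : 𝓢(Rn n, 𝕜)) : E →L[𝕜] 𝕜 :=
  (PointwiseConvergenceCLM.evalCLM (RingHom.id 𝕜) 𝕜 φ) ∘L ι

/-- Translations are isometries, so the bound is uniform in `y`. It makes elements of `E` bounded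
distributions and drives both closed graph arguments. -/
lemma IsTranslationInvariantSpace.norm_translate_le (h : IsTranslationInvariantSpace ι)
    (φ : 𝓢(Rn n, 𝕜)) (u : E) (y : Rn n) :
    ‖translate y (ι u) φ‖ ≤ ‖pairingCLM ι φ‖ * ‖u‖ := by
  obtain ⟨w, hw, hwn⟩ := h.translation u y
  rw [← hw, ← hwn]
  exact (pairingCLM ι φ).le_opNorm w

lemma IsTranslationInvariantSpace.isBoundedDistribution (h : IsTranslationInvariantSpace ι)
    (u : E) : IsBoundedDistribution (ι u) :=
  fun φ ↦ ⟨_, fun y ↦ h.norm_translate_le φ u y⟩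

variable [NormedSpace ℝ E] [IsScalarTower ℝ 𝕜 E]

lemma map_real_smul (ι : E →L[𝕜] Tempered 𝕜 n) (c : ℝ) (u : E) : ι (c • u) = (c : 𝕜) • ι u := by
  rw [RCLike.real_smul_eq_coe_smul (K := 𝕜), map_smul]

variable [CompleteSpace E]

/-- The convolution `k * u` with a fixed element `u` of `E`, as a bounded operator on `L¹`. -/
def convolutionVec (h : IsTranslationInvariantSpace ι) (u : E) :
    Lp ℝ 1 (volume : Measure (Rn n)) →L[ℝ] E :=
  ContinuousLinearMap.ofSeqClosedGraph (g :=
    { toFun k := (h.convolution k (L1.integrable_coeFn k) u).choose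
      map_add' k k' := by
        refine h.injective ?_
        have h1 := (h.convolution k (L1.integrable_coeFn k) u).choose_spec
        have h2 := (h.convolution k' (L1.integrable_coeFn k') u).choose_spec
        have h3 := (h.convolution _ (L1.integrable_coeFn (k + k')) u).choose_spec
        rw [map_add]
        exact (h3.congr_ae (Lp.coeFn_add k k')).unique (h1.add_kernel (L1.integrable_coeFn k)
          (L1.integrable_coeFn k') (h.isBoundedDistribution u) h2)
      map_smul' c k := by
        refine h.injective ?_
        have h1 := (h.convolution k (L1.integrable_coeFn k) u).choose_spec
        have h3 := (h.convolution _ (L1.integrable_coeFn (c • k)) u).choose_spec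
        rw [RingHom.id_apply, map_real_smul]
        exact (h3.congr_ae (Lp.coeFn_smul c k)).unique (h1.smul_kernel c) })
    (by
      -- The averaging axiom supplies no norm bound; the closed graph theorem does. Limits are
      -- identified after pairing with a test function, where the uniform bound on translates
      -- applies.
      intro k k₀ x hk hx
      refine h.injective ?_
      ext φ
      have hspec : ∀ k : Lp ℝ 1 (volume : Measure (Rn n)),
          ι (h.convolution k (L1.integrable_coeFn k) u).choose φ =
          ∫ y, k y • translate y (ι u) φ :=
        fun k ↦ (h.convolution k (L1.integrable_coeFn k) u).choose_spec φ
      have h1 := ((pairingCLM ι φ).continuous.tendsto x).comp hx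
      refine tendsto_nhds_unique h1 ?_
      change Tendsto (fun m ↦ ι (h.convolution (k m) (L1.integrable_coeFn (k m)) u).choose φ) _
        (𝓝 (ι (h.convolution k₀ (L1.integrable_coeFn k₀) u).choose φ))
      simp_rw [hspec]
      rw [tendsto_iff_norm_sub_tendsto_zero]
      rw [tendsto_iff_norm_sub_tendsto_zero] at hk
      have h2 := hk.mul_const (‖pairingCLM ι φ‖ * ‖u‖)
      rw [zero_mul] at h2
      refine squeeze_zero (fun _ ↦ norm_nonneg _) (fun m ↦ ?_) h2
      have hb := h.isBoundedDistribution u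
      rw [← integral_sub (hb.integrable (L1.integrable_coeFn _) φ)
        (hb.integrable (L1.integrable_coeFn _) φ), L1.norm_eq_integral_norm, ← integral_mul_const]
      refine norm_integral_le_of_norm_le ((L1.integrable_coeFn _).norm.mul_const _) ?_
      filter_upwards [Lp.coeFn_sub (k m) k₀] with y hy
      rw [hy, ← sub_smul, norm_smul, Pi.sub_apply]
      gcongr
      exact h.norm_translate_le φ u y)

lemma isConvolution_convolutionVec (h : IsTranslationInvariantSpace ι) (u : E)
    (k : Lp ℝ 1 (volume : Measure (Rn n))) :
    IsConvolution k (ι u) (ι (convolutionVec h u k)) :=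
  (h.convolution k (L1.integrable_coeFn k) u).choose_spec

/-- The convolution `k * u` as a bounded bilinear map of `u ∈ E` and `k ∈ L¹`. -/
def convolutionCLM (h : IsTranslationInvariantSpace ι) :
    E →L[ℝ] Lp ℝ 1 (volume : Measure (Rn n)) →L[ℝ] E :=
  ContinuousLinearMap.ofSeqClosedGraph (g :=
    { toFun u := convolutionVec h u
      map_add' u v := by
        ext k
        refine h.injective ?_
        rw [add_apply, map_add]
        refine (isConvolution_convolutionVec h (u + v) k).unique ?_
        rw [map_add]
        exact (isConvolution_convolutionVec h u k).add (L1.integrable_coeFn k)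
          (h.isBoundedDistribution u) (h.isBoundedDistribution v)
          (isConvolution_convolutionVec h v k)
      map_smul' c u := by
        ext k
        refine h.injective ?_
        rw [RingHom.id_apply, smul_apply, map_real_smul]
        refine (isConvolution_convolutionVec h (c • u) k).unique ?_
        rw [map_real_smul]
        exact (isConvolution_convolutionVec h u k).smul _ })
    (by
      intro u u₀ T hu hT
      ext k
      refine h.injective ?_
      ext φ
      have h0 := ((ContinuousLinearMap.apply ℝ E k).continuous.tendsto T).comp hT
      have h1 := ((pairingCLM ι φ).continuous.tendsto (T k)).comp h0
      refine tendsto_nhds_unique h1 ?_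
      change Tendsto (fun m ↦ ι (convolutionVec h (u m) k) φ) _
        (𝓝 (ι (convolutionVec h u₀ k) φ))
      simp_rw [isConvolution_convolutionVec h _ k φ]
      rw [tendsto_iff_norm_sub_tendsto_zero]
      rw [tendsto_iff_norm_sub_tendsto_zero] at hu
      have h2 := (hu.const_mul ‖pairingCLM ι φ‖).const_mul ‖k‖
      rw [mul_zero, mul_zero] at h2
      refine squeeze_zero (fun _ ↦ norm_nonneg _) (fun m ↦ ?_) h2
      rw [← integral_sub ((h.isBoundedDistribution _).integrable (L1.integrable_coeFn _) φ)
        ((h.isBoundedDistribution _).integrable (L1.integrable_coeFn _) φ),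
        L1.norm_eq_integral_norm, ← integral_mul_const]
      refine norm_integral_le_of_norm_le ((L1.integrable_coeFn _).norm.mul_const _)
        (.of_forall fun y ↦ ?_)
      rw [← smul_sub, norm_smul]
      gcongr
      have := h.norm_translate_le φ (u m - u₀) y
      rwa [map_sub, translate_sub] at this)

lemma isConvolution_convolutionCLM (h : IsTranslationInvariantSpace ι) (u : E)
    (k : Lp ℝ 1 (volume : Measure (Rn n))) :
    IsConvolution k (ι u) (ι (convolutionCLM h u k)) :=
  isConvolution_convolutionVec h u k

/-- The operator `S_β(t)` on `E`. -/
def evolutionCLM (h : IsTranslationInvariantSpace ι) (β t : ℝ) : E →L[ℝ] E :=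
  (convolutionCLM h).flip (kernelL1 n β t)

lemma isEvolution_evolutionCLM (h : IsTranslationInvariantSpace ι) {β t : ℝ} (hβ : 0 < β)
    (ht : 0 < t) (u : E) : IsEvolution β t (ι u) (ι (evolutionCLM h β t u)) :=
  ⟨h.isBoundedDistribution u,
    (isConvolution_convolutionCLM h u _).congr_ae (coeFn_kernelL1 hβ ht)⟩

lemma continuousOn_evolutionCLM (h : IsTranslationInvariantSpace ι) {β : ℝ} (hβ : 0 < β) :
    ContinuousOn (evolutionCLM h β) (Ioi 0) :=
  (convolutionCLM h).flip.continuous.comp_continuousOn (continuousOn_kernelL1 hβ)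

/-- If `x = S_β(t) f` and `w = S_β(s + t) f` in `E`, then `w = S_β(s) x`. -/
lemma IsEvolution.evolutionCLM_eq (h : IsTranslationInvariantSpace ι) {β s t : ℝ} (hβ : 0 < β)
    (hs : 0 < s) (ht : 0 < t) {f : Tempered 𝕜 n} {x w : E} (hx : IsEvolution β t f (ι x))
    (hw : IsEvolution β (s + t) f (ι w)) : evolutionCLM h β s x = w :=
  h.injective ((hx.trans hβ hs ht (isEvolution_evolutionCLM h hβ hs x)).unique hw)

end SpaceEvolution

/-! ### Scaling of the smoothing bound and the smoothed multilinear maps -/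

section SmoothingMap

variable {𝕜 : Type*} [RCLike 𝕜] {n : ℕ} {E F : Type*} [NormedAddCommGroup E] [NormedSpace 𝕜 E]
  [NormedAddCommGroup F] [NormedSpace 𝕜 F] {ι : E →L[𝕜] Tempered 𝕜 n} {m : ℕ}
  {B : MultilinearMap 𝕜 (fun _ : Fin m ↦ F) (Tempered 𝕜 n)} {β : ℝ} {ω : ℝ → ℝ}

lemma dilate_smul {l : ℝ} (hl : 0 < l) (c : 𝕜) (f : Tempered 𝕜 n) :
    dilate l hl (c • f) = c • dilate l hl f := by
  ext φ
  exact mul_left_comm _ _ _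

/-- By scaling, the smoothing bound at a single time determines the bound at all times. -/
lemma exists_smoothingBound {ιF : F →L[𝕜] Tempered 𝕜 n} {a b σ : ℝ} (hβ : 0 < β)
    (ha : HasScalingDegree ι a) (hb : HasScalingDegree ιF b)
    (hσ : FormHasScalingDegree ιF B σ) (hω : 0 < ω 1) (h : SmoothingBound β ι B ω) :
    ∃ C : ℝ, 0 < C ∧ SmoothingBound β ι B fun t ↦ C * t ^ ((m * b - a - σ) / β) := by
  refine ⟨ω 1, hω, fun t ht v ↦ ?_⟩
  -- With `l^β = t`, the bound at time 1 for the dilated arguments becomes, after dilating back by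
  -- `1/l`, the bound at time `t`.
  set l : ℝ := t ^ (1 / β) with hl_def
  have hl : 0 < l := by positivity
  have hlβ : l ^ β * 1 = t := by
    rw [hl_def, ← Real.rpow_mul ht.le, one_div_mul_cancel hβ.ne', Real.rpow_one, mul_one]
  choose w hw hwn using fun i ↦ hb (v i) l hl
  obtain ⟨z, hz, hzn⟩ := h 1 one_pos w
  obtain ⟨z', hz', hzn'⟩ := ha z l⁻¹ (inv_pos.2 hl)
  have hB := hσ l hl v w hw
  have hlσ : ((l ^ σ : ℝ) : 𝕜) ≠ 0 := by
    rw [Ne, RCLike.ofReal_eq_zero]; positivity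
  refine ⟨((l ^ σ : ℝ) : 𝕜)⁻¹ • z', ?_, ?_⟩
  · have h1 := hz.smul (((l ^ σ : ℝ) : 𝕜)⁻¹)
    have h2 : ((l ^ σ : ℝ) : 𝕜)⁻¹ • B w = dilate l hl (B v) := by
      rw [hB]
      ext φ
      exact inv_smul_smul₀ hlσ _
    rw [h2] at h1
    have h3 := h1.of_dilate hl
    rw [hlβ, dilate_smul, ← hz', ← map_smul] at h3
    exact h3
  · rw [norm_smul, norm_inv, RCLike.norm_ofReal, abs_of_pos (by positivity), hzn']
    have h4 : ∏ i, ‖w i‖ = l ^ (m * b) * ∏ i, ‖v i‖ := by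
      simp_rw [hwn]
      rw [Finset.prod_mul_distrib, Finset.prod_const, Finset.card_fin, mul_comm (m : ℝ),
        Real.rpow_mul hl.le, Real.rpow_natCast]
    rw [h4] at hzn
    have h5 : t ^ ((m * b - a - σ) / β) = (l ^ σ)⁻¹ * (l⁻¹ ^ a * l ^ (m * b)) := by
      rw [Real.inv_rpow hl.le, ← Real.rpow_neg hl.le, ← Real.rpow_neg hl.le, ← Real.rpow_add hl,
        ← Real.rpow_add hl, hl_def, ← Real.rpow_mul ht.le]
      congr 1
      ring
    beta_reduce
    rw [h5]
    calc (l ^ σ)⁻¹ * (l⁻¹ ^ a * ‖z‖)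
        ≤ (l ^ σ)⁻¹ * (l⁻¹ ^ a * (ω 1 * (l ^ (m * b) * ∏ i, ‖v i‖))) := by gcongr
      _ = _ := by ring

/-- The bounded multilinear map `S_β(t) B` from `F^m` to `E`. -/
def smoothingMap (hι : Function.Injective ι) (hβ : 0 < β) (h : SmoothingBound β ι B ω) {t : ℝ}
    (ht : 0 < t) : ContinuousMultilinearMap 𝕜 (fun _ : Fin m ↦ F) E :=
  MultilinearMap.mkContinuous
    { toFun v := (h t ht v).choose
      map_update_add' v i x y := by
        refine hι ?_
        have h1 : IsEvolution β t (B (Function.update v i x) + B (Function.update v i y))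
            (ι (h t ht (Function.update v i (x + y))).choose) := by
          rw [← B.map_update_add]
          exact (h t ht (Function.update v i (x + y))).choose_spec.1
        rw [map_add]
        exact h1.unique ((h t ht _).choose_spec.1.add hβ ht (h t ht _).choose_spec.1)
      map_update_smul' v i c x := by
        refine hι ?_
        have h1 : IsEvolution β t (c • B (Function.update v i x))
            (ι (h t ht (Function.update v i (c • x))).choose) := by
          rw [← B.map_update_smul]
          exact (h t ht (Function.update v i (c • x))).choose_spec.1
        rw [map_smul]
        exact h1.unique ((h t ht _).choose_spec.1.smul c) }
    (ω t) fun v ↦ (h t ht v).choose_spec.2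

lemma isEvolution_smoothingMap (hι : Function.Injective ι) (hβ : 0 < β)
    (h : SmoothingBound β ι B ω) {t : ℝ} (ht : 0 < t) (v : Fin m → F) :
    IsEvolution β t (B v) (ι (smoothingMap hι hβ h ht v)) :=
  (h t ht v).choose_spec.1

lemma norm_smoothingMap_le (hι : Function.Injective ι) (hβ : 0 < β)
    (h : SmoothingBound β ι B ω) {t : ℝ} (ht : 0 < t) (hω : 0 ≤ ω t) :
    ‖smoothingMap hι hβ h ht‖ ≤ ω t :=
  MultilinearMap.mkContinuous_norm_le _ hω _

/-- If `w = S_β(t) B(v, …, v)` in `E`, then `w` is bounded in terms of `v`; more generally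
differences of such elements are bounded in terms of differences. -/
lemma SmoothingBound.norm_sub_le (hι : Function.Injective ι) (hβ : 0 < β)
    (h : SmoothingBound β ι B ω) {t : ℝ} (ht : 0 < t) (hω : 0 ≤ ω t) {v v' : F} {w w' : E}
    (hw : IsEvolution β t (B fun _ ↦ v) (ι w)) (hw' : IsEvolution β t (B fun _ ↦ v') (ι w'))
    {N D : ℝ} (hv : ‖v‖ ≤ N) (hv' : ‖v'‖ ≤ N) (hD : ‖v - v'‖ ≤ D) :
    ‖w - w'‖ ≤ ω t * (m * N ^ (m - 1) * D) := by
  have e := hι (hw.unique (isEvolution_smoothingMap hι hβ h ht _))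
  have e' := hι (hw'.unique (isEvolution_smoothingMap hι hβ h ht _))
  have h1 := (smoothingMap hι hβ h ht).norm_image_sub_le (fun _ ↦ v) fun _ ↦ v'
  rw [← e, ← e', Fintype.card_fin] at h1
  refine h1.trans ?_
  have hN : 0 ≤ N := (norm_nonneg _).trans hv
  rw [← mul_assoc, ← mul_assoc]
  gcongr
  · exact norm_smoothingMap_le hι hβ h ht hω
  · exact max_le ((pi_norm_const_le _).trans hv) ((pi_norm_const_le _).trans hv')
  · exact (pi_norm_const_le (ι := Fin m) (v - v')).trans hD

end SmoothingMap

/-! ### Beta integrals -/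

section PowerIntegrals

open intervalIntegral

lemma intervalIntegrable_one_sub_rpow_mul_rpow {x y : ℝ} (hx : -1 < x) (hy : -1 < y) :
    IntervalIntegrable (fun s : ℝ ↦ (1 - s) ^ x * s ^ y) volume 0 1 := by
  have h := (Complex.betaIntegral_convergent (u := ((y + 1 : ℝ) : ℂ)) (v := ((x + 1 : ℝ) : ℂ))
    (by simp; linarith) (by simp; linarith)).norm
  rw [intervalIntegrable_iff_integrableOn_Ioo_of_le zero_le_one] at h ⊢
  refine h.congr_fun (fun s hs ↦ ?_) measurableSet_Ioo
  have h1 : (1 - (s : ℂ)) = ((1 - s : ℝ) : ℂ) := by push_cast; rfl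
  beta_reduce
  rw [h1, norm_mul, Complex.norm_cpow_eq_rpow_re_of_pos hs.1,
    Complex.norm_cpow_eq_rpow_re_of_pos (by linarith [hs.2]), mul_comm]
  simp

lemma setIntegral_Ioo_eq_smul {E : Type*} [NormedAddCommGroup E] [NormedSpace ℝ E] (f : ℝ → E)
    {t : ℝ} (ht : 0 < t) : ∫ τ in Ioo 0 t, f τ = ∫ s in Ioo (0 : ℝ) 1, t • f (t * s) := by
  rw [← integral_Ioc_eq_integral_Ioo, ← integral_Ioc_eq_integral_Ioo, ← integral_of_le ht.le,
    ← integral_of_le zero_le_one, intervalIntegral.integral_smul, smul_integral_comp_mul_left,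
    mul_zero, mul_one]

lemma sub_rpow_mul_rpow_eq {t s : ℝ} (ht : 0 < t) (hs : s ∈ Ioo (0 : ℝ) 1) (x y : ℝ) :
    (t - t * s) ^ x * (t * s) ^ y = t ^ (x + y) * ((1 - s) ^ x * s ^ y) := by
  rw [show t - t * s = t * (1 - s) by ring, Real.mul_rpow ht.le (by linarith [hs.2]),
    Real.mul_rpow ht.le hs.1.le, Real.rpow_add ht]
  ring

lemma integrableOn_sub_rpow_mul_rpow {x y t : ℝ} (hx : -1 < x) (hy : -1 < y) (ht : 0 < t) :
    IntegrableOn (fun τ : ℝ ↦ (t - τ) ^ x * τ ^ y) (Ioo 0 t) := by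
  have h := ((intervalIntegrable_one_sub_rpow_mul_rpow hx hy).comp_mul_left (c := t⁻¹)).const_mul
    (t ^ (x + y))
  rw [zero_div, one_div, inv_inv, intervalIntegrable_iff_integrableOn_Ioo_of_le ht.le] at h
  refine h.congr_fun (fun τ hτ ↦ ?_) measurableSet_Ioo
  have h1 : t⁻¹ * τ ∈ Ioo (0 : ℝ) 1 := by
    refine ⟨mul_pos (inv_pos.2 ht) hτ.1, ?_⟩
    rw [inv_mul_lt_iff₀ ht, mul_one]
    exact hτ.2
  beta_reduce
  rw [← sub_rpow_mul_rpow_eq ht h1, mul_inv_cancel_left₀ ht.ne']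

lemma setIntegral_sub_rpow_mul_rpow {x y t : ℝ} (ht : 0 < t) :
    ∫ τ in Ioo 0 t, (t - τ) ^ x * τ ^ y =
      t ^ (x + y + 1) * ∫ s in (0 : ℝ)..1, (1 - s) ^ x * s ^ y := by
  rw [setIntegral_Ioo_eq_smul _ ht, integral_of_le zero_le_one, integral_Ioc_eq_integral_Ioo,
    ← MeasureTheory.integral_const_mul]
  refine setIntegral_congr_fun measurableSet_Ioo fun s hs ↦ ?_
  rw [sub_rpow_mul_rpow_eq ht hs, smul_eq_mul, Real.rpow_add_one ht.ne']
  ring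

lemma norm_setIntegral_le_rpow {E : Type*} [NormedAddCommGroup E] [NormedSpace ℝ E] {g : ℝ → E}
    {A x y t : ℝ} (hx : -1 < x) (hy : -1 < y) (ht : 0 < t)
    (hg : ∀ τ ∈ Ioo 0 t, ‖g τ‖ ≤ A * ((t - τ) ^ x * τ ^ y)) :
    ‖∫ τ in Ioo 0 t, g τ‖ ≤
      A * t ^ (x + y + 1) * ∫ s in (0 : ℝ)..1, (1 - s) ^ x * s ^ y := by
  refine (MeasureTheory.norm_integral_le_of_norm_le
    ((integrableOn_sub_rpow_mul_rpow hx hy ht).const_mul A)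
    ?_).trans_eq ?_
  · exact (ae_restrict_iff' measurableSet_Ioo).2 (.of_forall hg)
  · rw [MeasureTheory.integral_const_mul, setIntegral_sub_rpow_mul_rpow ht, mul_assoc]

lemma integral_one_sub_rpow_mul_rpow_nonneg (x y : ℝ) :
    0 ≤ ∫ s in (0 : ℝ)..1, (1 - s) ^ x * s ^ y :=
  integral_nonneg zero_le_one fun s hs ↦
    mul_nonneg (Real.rpow_nonneg (by linarith [hs.2]) _) (Real.rpow_nonneg hs.1 _)

end PowerIntegrals

/-! ### Properties of `beNorm` and `pathNorm` -/

section Norms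

variable {𝕜 : Type*} [RCLike 𝕜] {n : ℕ} {E : Type*} [NormedAddCommGroup E]
  [NormedSpace 𝕜 E] {ι : E →L[𝕜] Tempered 𝕜 n} {β α : ℝ}

lemma ofReal_mul_enorm_le_beNorm (hι : Function.Injective ι) {f : Tempered 𝕜 n} {t : ℝ}
    (ht : 0 < t) {w : E} (hw : IsEvolution β t f (ι w)) :
    ENNReal.ofReal (t ^ (α / β)) * ‖w‖ₑ ≤ beNorm β α ι f := by
  refine le_trans ?_ (le_iSup₂ (f := fun (t : ℝ) (_ : 0 < t) ↦ ENNReal.ofReal (t ^ (α / β)) *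
    ⨅ (w : E) (_ : IsEvolution β t f (ι w)), ‖w‖ₑ) t ht)
  gcongr
  refine le_iInf₂ fun w' hw' ↦ ?_
  rw [hι (hw'.unique hw)]

lemma beNorm_le {f : Tempered 𝕜 n} {c : ℝ≥0∞} (h : ∀ t, 0 < t → ∃ w : E,
    IsEvolution β t f (ι w) ∧ ENNReal.ofReal (t ^ (α / β)) * ‖w‖ₑ ≤ c) :
    beNorm β α ι f ≤ c := by
  refine iSup₂_le fun t ht ↦ ?_
  obtain ⟨w, hw, hwc⟩ := h t ht
  refine le_trans ?_ hwc
  gcongr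
  exact iInf₂_le w hw

/-- Otherwise some infimum runs over the empty set and equals `∞`, and its weight `t^(α/β)` is
positive. -/
lemma exists_isEvolution_of_beNorm_ne_top {f : Tempered 𝕜 n} (h : beNorm β α ι f ≠ ∞) {t : ℝ}
    (ht : 0 < t) : ∃ w : E, IsEvolution β t f (ι w) := by
  by_contra! hcon
  refine h (top_le_iff.1 ?_)
  refine le_trans ?_ (le_iSup₂ (f := fun (t : ℝ) (_ : 0 < t) ↦ ENNReal.ofReal (t ^ (α / β)) *
    ⨅ (w : E) (_ : IsEvolution β t f (ι w)), ‖w‖ₑ) t ht)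
  have : ⨅ (w : E) (_ : IsEvolution β t f (ι w)), ‖w‖ₑ = ∞ := by simp [hcon]
  rw [this, ENNReal.mul_top]
  simp only [ne_eq, ENNReal.ofReal_eq_zero, not_le]
  positivity

lemma ofReal_mul_enorm_le_pathNorm (u : ℝ → E) {t : ℝ} (ht : 0 < t) :
    ENNReal.ofReal (t ^ (α / β)) * ‖u t‖ₑ ≤ pathNorm β α ι u :=
  le_trans (le_iSup₂ (f := fun (t : ℝ) (_ : 0 < t) ↦ ENNReal.ofReal (t ^ (α / β)) * ‖u t‖ₑ) t ht)
    le_self_add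

lemma ofReal_rpow_mul_enorm_le_iff {t M : ℝ} (ht : 0 < t) (hM : 0 ≤ M) (x : E) :
    ENNReal.ofReal (t ^ (α / β)) * ‖x‖ₑ ≤ ENNReal.ofReal M ↔ ‖x‖ ≤ M * t ^ (-α / β) := by
  rw [← ofReal_norm, ← ENNReal.ofReal_mul (by positivity), ENNReal.ofReal_le_ofReal_iff hM,
    neg_div, Real.rpow_neg ht.le, ← div_eq_mul_inv, le_div_iff₀ (by positivity), mul_comm]

lemma norm_le_of_pathNorm_le {u : ℝ → E} {M : ℝ} (hM : 0 ≤ M)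
    (h : pathNorm β α ι u ≤ ENNReal.ofReal M) {t : ℝ} (ht : 0 < t) :
    ‖u t‖ ≤ M * t ^ (-α / β) :=
  (ofReal_rpow_mul_enorm_le_iff ht hM _).1 ((ofReal_mul_enorm_le_pathNorm u ht).trans h)

lemma pathNorm_congr {u u' : ℝ → E} (h : ∀ t, 0 < t → u t = u' t) :
    pathNorm β α ι u = pathNorm β α ι u' := by
  unfold pathNorm
  congr 1
  · exact iSup_congr fun t ↦ iSup_congr fun ht ↦ by rw [h t ht]
  · exact iSup_congr fun t ↦ iSup_congr fun ht ↦ by rw [h t ht]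

lemma pathNorm_le {u : ℝ → E} {c d : ℝ≥0∞}
    (h : ∀ t, 0 < t → ENNReal.ofReal (t ^ (α / β)) * ‖u t‖ₑ ≤ c)
    (h' : ∀ t, 0 < t → beNorm β α ι (ι (u t)) ≤ d) : pathNorm β α ι u ≤ c + d :=
  add_le_add (iSup₂_le h) (iSup₂_le h')

lemma isBoundedDistribution_zero : IsBoundedDistribution (0 : Tempered 𝕜 n) :=
  fun _ ↦ ⟨0, fun _ ↦ norm_zero.le⟩

lemma isEvolution_zero (β t : ℝ) : IsEvolution β t (0 : Tempered 𝕜 n) 0 :=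
  ⟨isBoundedDistribution_zero, fun φ ↦ by
    change (0 : 𝕜) = ∫ y, kernel β t y • (0 : 𝕜)
    simp⟩

lemma beNorm_zero : beNorm β α ι (0 : Tempered 𝕜 n) = 0 := by
  refine le_antisymm (beNorm_le fun t _ ↦ ⟨0, ?_, by simp⟩) zero_le
  rw [map_zero]
  exact isEvolution_zero β t

variable [NormedSpace ℝ E] [IsScalarTower ℝ 𝕜 E] [CompleteSpace E]

lemma beNorm_add_le (h : IsTranslationInvariantSpace ι) (hβ : 0 < β) (x y : E) :
    beNorm β α ι (ι (x + y)) ≤ beNorm β α ι (ι x) + beNorm β α ι (ι y) := by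
  refine beNorm_le fun t ht ↦ ⟨_, isEvolution_evolutionCLM h hβ ht (x + y), ?_⟩
  rw [map_add]
  refine (mul_le_mul_right (enorm_add_le _ _) _).trans ?_
  rw [mul_add]
  exact add_le_add
    (ofReal_mul_enorm_le_beNorm h.injective ht (isEvolution_evolutionCLM h hβ ht x))
    (ofReal_mul_enorm_le_beNorm h.injective ht (isEvolution_evolutionCLM h hβ ht y))

lemma pathNorm_add_le (h : IsTranslationInvariantSpace ι) (hβ : 0 < β) (u w : ℝ → E) :
    pathNorm β α ι (u + w) ≤ pathNorm β α ι u + pathNorm β α ι w := by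
  unfold pathNorm
  rw [add_add_add_comm]
  refine add_le_add (iSup₂_le fun t ht ↦ ?_) (iSup₂_le fun t ht ↦ ?_)
  · refine (mul_le_mul_right (enorm_add_le (u t) (w t)) _).trans ?_
    rw [mul_add]
    exact add_le_add
      (le_iSup₂ (f := fun (t : ℝ) (_ : 0 < t) ↦ ENNReal.ofReal (t ^ (α / β)) * ‖u t‖ₑ) t ht)
      (le_iSup₂ (f := fun (t : ℝ) (_ : 0 < t) ↦ ENNReal.ofReal (t ^ (α / β)) * ‖w t‖ₑ) t ht)
  · refine (beNorm_add_le h hβ (u t) (w t)).trans ?_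
    exact add_le_add
      (le_iSup₂ (f := fun (t : ℝ) (_ : 0 < t) ↦ beNorm β α ι (ι (u t))) t ht)
      (le_iSup₂ (f := fun (t : ℝ) (_ : 0 < t) ↦ beNorm β α ι (ι (w t))) t ht)

lemma IsEvolution.comp_evolutionCLM (h : IsTranslationInvariantSpace ι) (hβ : 0 < β) {s t : ℝ}
    (hs : 0 < s) (ht : 0 < t) {f : Tempered 𝕜 n} {x : E} (hx : IsEvolution β t f (ι x)) :
    IsEvolution β (s + t) f (ι (evolutionCLM h β s x)) :=
  hx.trans hβ hs ht (isEvolution_evolutionCLM h hβ hs x)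

/-- The linear evolution is bounded by the norm of the initial datum. -/
lemma beNorm_evolution_le (h : IsTranslationInvariantSpace ι) (hβ : 0 < β) (hα : 0 < α) {t : ℝ}
    (ht : 0 < t) {f : Tempered 𝕜 n} {x : E} (hx : IsEvolution β t f (ι x)) :
    beNorm β α ι (ι x) ≤ beNorm β α ι f := by
  refine beNorm_le fun s hs ↦ ⟨_, isEvolution_evolutionCLM h hβ hs x, ?_⟩
  -- `S_β(s) S_β(t) f = S_β(s + t) f`, and `s^(α/β) ≤ (s + t)^(α/β)` since `α > 0`.
  refine le_trans ?_ (ofReal_mul_enorm_le_beNorm (α := α) h.injective (add_pos hs ht)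
    (hx.comp_evolutionCLM h hβ hs ht))
  gcongr
  linarith

/-- Each of the two summands of the path norm costs one `beNorm`; this is the origin of the factor 2
in the theorem. -/
lemma pathNorm_evolution_le (h : IsTranslationInvariantSpace ι) (hβ : 0 < β) (hα : 0 < α)
    {f : Tempered 𝕜 n} {x : ℝ → E} (hx : ∀ t, 0 < t → IsEvolution β t f (ι (x t))) :
    pathNorm β α ι x ≤ 2 * beNorm β α ι f := by
  rw [two_mul]
  exact pathNorm_le (fun t ht ↦ ofReal_mul_enorm_le_beNorm h.injective ht (hx t ht))
    fun t ht ↦ beNorm_evolution_le h hβ hα ht (hx t ht)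

end Norms

/-! ### Estimates for Duhamel integrals -/

section Duhamel

open Filter Topology

variable {𝕜 : Type*} [RCLike 𝕜] {n : ℕ} {E F : Type*} [NormedAddCommGroup E]
  [NormedSpace 𝕜 E] {ι : E →L[𝕜] Tempered 𝕜 n} {β α α' γ C : ℝ}
  [NormedSpace ℝ E] [IsScalarTower ℝ 𝕜 E] [CompleteSpace E] [NormedAddCommGroup F]
  [NormedSpace 𝕜 F] {m : ℕ} {B : MultilinearMap 𝕜 (fun _ : Fin m ↦ F) (Tempered 𝕜 n)}

/-- The path norm of a Duhamel integral whose integrand obeys the smoothing estimates. -/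
lemma pathNorm_setIntegral_le (h : IsTranslationInvariantSpace ι) (hβ : 0 < β) (hα : 0 < α)
    (hαγ : α < γ) (hγ : γ < β) {κ A : ℝ} (hκ : κ = α + β - γ) (hA : 0 ≤ A) {g : ℝ → ℝ → E}
    (hgi : ∀ t, 0 < t → IntegrableOn (g t) (Ioo 0 t))
    (hg : ∀ t, 0 < t → ∀ τ ∈ Ioo 0 t, ‖g t τ‖ ≤ A * ((t - τ) ^ (-γ / β) * τ ^ (-κ / β)))
    (hg' : ∀ t, 0 < t → ∀ s, 0 < s → ∀ τ ∈ Ioo 0 t, ‖evolutionCLM h β s (g t τ)‖ ≤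
      A * ((s + (t - τ)) ^ (-γ / β) * τ ^ (-κ / β))) :
    pathNorm β α ι (fun t ↦ ∫ τ in Ioo 0 t, g t τ) ≤ ENNReal.ofReal (betaConst β A α γ κ) := by
  have e1 : -1 < -γ / β := by rw [lt_div_iff₀ hβ]; linarith
  have e2 : -1 < (α - γ) / β := by rw [lt_div_iff₀ hβ]; linarith
  have e3 : -1 < -κ / β := by rw [lt_div_iff₀ hβ]; linarith
  have hI1 := integral_one_sub_rpow_mul_rpow_nonneg (-γ / β) (-κ / β)
  have hI2 := integral_one_sub_rpow_mul_rpow_nonneg ((α - γ) / β) (-κ / β)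
  rw [betaConst, mul_add, ENNReal.ofReal_add (by positivity) (by positivity)]
  refine pathNorm_le (fun t ht ↦ ?_) fun t ht ↦ beNorm_le fun s hs ↦
    ⟨_, isEvolution_evolutionCLM h hβ hs _, ?_⟩
  · rw [ofReal_rpow_mul_enorm_le_iff ht (by positivity)]
    refine (norm_setIntegral_le_rpow e1 e3 ht (hg t ht)).trans_eq ?_
    have : -γ / β + -κ / β + 1 = -α / β := by rw [hκ]; field_simp; ring
    rw [this]; ring
  · rw [ofReal_rpow_mul_enorm_le_iff hs (by positivity),
      ← ContinuousLinearMap.integral_comp_comm _ (hgi t ht)]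
    have hb : ∀ τ ∈ Ioo 0 t, ‖evolutionCLM h β s (g t τ)‖ ≤
        A * s ^ (-α / β) * ((t - τ) ^ ((α - γ) / β) * τ ^ (-κ / β)) := by
      intro τ hτ
      refine (hg' t ht s hs τ hτ).trans ?_
      have ht' : 0 < t - τ := sub_pos.2 hτ.2
      -- Since `0 < α < γ`, both parts of the split exponent are negative. The first absorbs the
      -- weight `s^(α/β)`; the second leaves a Beta integral with total power `t^0`, so the bound is
      -- uniform in `s` and `t`.
      have h1 : (s + (t - τ)) ^ (-γ / β) ≤ s ^ (-α / β) * (t - τ) ^ ((α - γ) / β) := by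
        rw [show -γ / β = -α / β + (α - γ) / β by ring, Real.rpow_add (by positivity)]
        gcongr ?_ * ?_
        · exact Real.rpow_le_rpow_of_nonpos hs (by linarith)
            (div_nonpos_of_nonpos_of_nonneg (by linarith) hβ.le)
        · exact Real.rpow_le_rpow_of_nonpos ht' (by linarith)
            (div_nonpos_of_nonpos_of_nonneg (by linarith) hβ.le)
      have h2 : 0 ≤ τ ^ (-κ / β) := Real.rpow_nonneg hτ.1.le _
      calc A * ((s + (t - τ)) ^ (-γ / β) * τ ^ (-κ / β))
          ≤ A * (s ^ (-α / β) * (t - τ) ^ ((α - γ) / β) * τ ^ (-κ / β)) := by gcongr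
        _ = _ := by ring
    refine (norm_setIntegral_le_rpow e2 e3 ht hb).trans_eq ?_
    have : (α - γ) / β + -κ / β + 1 = 0 := by rw [hκ]; field_simp; ring
    rw [this, Real.rpow_zero]; ring

/-- The difference of two solutions of Duhamel's formula. -/
lemma IsDuhamel.pathNorm_sub_le (h : IsTranslationInvariantSpace ι) (hβ : 0 < β) (hα : 0 < α)
    (hαγ : α < γ) (hγ : γ < β) (hm : m ≠ 0) (hκ : m * α' = α + β - γ) (hC : 0 ≤ C)
    (hB : SmoothingBound β ι B fun t ↦ C * t ^ (-γ / β)) {u₀ u₀' : Tempered 𝕜 n}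
    {v v' : ℝ → F} {u u' : ℝ → E} {M D : ℝ}
    (hu : IsDuhamel β ι u₀ (fun τ ↦ B fun _ ↦ v τ) u)
    (hu' : IsDuhamel β ι u₀' (fun τ ↦ B fun _ ↦ v' τ) u')
    (hv : ∀ t, 0 < t → ‖v t‖ ≤ M * t ^ (-α' / β))
    (hv' : ∀ t, 0 < t → ‖v' t‖ ≤ M * t ^ (-α' / β))
    (hD : ∀ t, 0 < t → ‖v t - v' t‖ ≤ D * t ^ (-α' / β)) :
    pathNorm β α ι (u - u') ≤ 2 * beNorm β α ι (u₀ - u₀') +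
      ENNReal.ofReal (m * M ^ (m - 1) * D * betaConst β C α γ (m * α')) := by
  have hM0 : 0 ≤ M := by simpa using (norm_nonneg _).trans (hv 1 one_pos)
  have hD0 : 0 ≤ D := by simpa using (norm_nonneg _).trans (hD 1 one_pos)
  choose! x g hx hg hgi hu using hu
  choose! x' g' hx' hg' hgi' hu' using hu'
  set A : ℝ := m * M ^ (m - 1) * D * C with hA_def
  have hA : 0 ≤ A := by positivity
  -- The multilinear difference estimate gives `m - 1` factors of size `M τ^(-α'/β)` and one of size
  -- `D τ^(-α'/β)`.
  have hpow : ∀ τ : ℝ, 0 < τ → ∀ r : ℝ, C * r * (m * (M * τ ^ (-α' / β)) ^ (m - 1) *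
      (D * τ ^ (-α' / β))) = A * (r * τ ^ (-(m * α') / β)) := by
    intro τ hτ r
    have : τ ^ (-(m * α') / β) = (τ ^ (-α' / β)) ^ (m - 1) * τ ^ (-α' / β) := by
      rw [← pow_succ, Nat.sub_one_add_one hm, ← Real.rpow_natCast, ← Real.rpow_mul hτ.le]
      congr 1; ring
    rw [this, mul_pow, hA_def]; ring
  have hmain := pathNorm_setIntegral_le h hβ hα hαγ hγ hκ hA (g := fun t ↦ g t - g' t)
    (fun t ht ↦ (hgi t ht).sub (hgi' t ht))
    (fun t ht τ hτ ↦ by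
      have ht' : 0 < t - τ := sub_pos.2 hτ.2
      rw [← hpow τ hτ.1]
      exact hB.norm_sub_le h.injective hβ ht' (by positivity) (hg t ht τ hτ) (hg' t ht τ hτ)
        (hv τ hτ.1) (hv' τ hτ.1) (hD τ hτ.1))
    (fun t ht s hs τ hτ ↦ by
      have ht' : 0 < t - τ := sub_pos.2 hτ.2
      rw [← hpow τ hτ.1, Pi.sub_apply, map_sub]
      exact hB.norm_sub_le h.injective hβ (add_pos hs ht') (by positivity)
        ((hg t ht τ hτ).comp_evolutionCLM h hβ hs ht')
        ((hg' t ht τ hτ).comp_evolutionCLM h hβ hs ht') (hv τ hτ.1) (hv' τ hτ.1) (hD τ hτ.1))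
  have hlin := pathNorm_evolution_le (α := α) (x := fun t ↦ x t - x' t) (f := u₀ - u₀') h hβ hα
    fun t ht ↦ by
      rw [map_sub]
      exact (hx t ht).sub hβ ht (hx' t ht)
  have hsplit : pathNorm β α ι (u - u') = pathNorm β α ι ((fun t ↦ x t - x' t) +
      fun t ↦ ∫ τ in Ioo 0 t, (g t - g' t) τ) := by
    refine pathNorm_congr fun t ht ↦ ?_
    simp only [Pi.add_apply, Pi.sub_apply]
    rw [integral_sub (hgi t ht) (hgi' t ht), hu t ht, hu' t ht]
    abel
  rw [hsplit]
  refine (pathNorm_add_le h hβ _ _).trans (add_le_add hlin (hmain.trans_eq ?_))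
  rw [betaConst, betaConst, hA_def]
  congr 1; ring

end Duhamel

/-! ### Continuity in time and existence of Duhamel integrals -/

section Existence

open Filter Topology

variable {𝕜 : Type*} [RCLike 𝕜] {n : ℕ} {E F : Type*} [NormedAddCommGroup E]
  [NormedSpace 𝕜 E] {ι : E →L[𝕜] Tempered 𝕜 n} {β α α' γ C : ℝ}
  [NormedSpace ℝ E] [IsScalarTower ℝ 𝕜 E] [CompleteSpace E] [NormedAddCommGroup F]
  [NormedSpace 𝕜 F] {m : ℕ} {B : MultilinearMap 𝕜 (fun _ : Fin m ↦ F) (Tempered 𝕜 n)}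
  {X : Type*} [TopologicalSpace X]

/-- Smoothing makes the evolution of data in `E` continuous in time. -/
lemma continuousOn_of_isEvolution (h : IsTranslationInvariantSpace ι) (hβ : 0 < β)
    {f : Tempered 𝕜 n} {x : ℝ → E} (hx : ∀ t, 0 < t → IsEvolution β t f (ι (x t))) :
    ContinuousOn x (Ioi 0) := by
  intro t ht
  rw [mem_Ioi] at ht
  -- Near `t` the path is `S_β(s - t/2)` applied to its fixed value at `t/2`, and the operator is
  -- norm continuous.
  have hc : ContinuousAt (fun s ↦ evolutionCLM h β (s - t / 2) (x (t / 2))) t := by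
    have h1 : ContinuousAt (evolutionCLM h β) (t - t / 2) :=
      (continuousOn_evolutionCLM h hβ).continuousAt (Ioi_mem_nhds (by linarith))
    have h2 : ContinuousAt (fun s ↦ evolutionCLM h β (s - t / 2)) t :=
      h1.comp (f := fun s ↦ s - t / 2) (by fun_prop)
    exact h2.clm_apply continuousAt_const
  refine (hc.congr ?_).continuousWithinAt
  filter_upwards [eventually_gt_nhds (show t / 2 < t by linarith)] with s hs
  refine (hx (t / 2) (by linarith)).evolutionCLM_eq h hβ (by linarith) (by linarith) ?_
  rw [sub_add_cancel]
  exact hx s (by linarith)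

/-- The smoothed forms are continuous in time and in their argument. -/
lemma continuousOn_of_isEvolution_form (h : IsTranslationInvariantSpace ι) (hβ : 0 < β)
    {ω : ℝ → ℝ} (hB : SmoothingBound β ι B ω) {S : Set X} {f : X → ℝ} {v : X → F} {w : X → E}
    (hf : ContinuousOn f S) (hf0 : ∀ x ∈ S, 0 < f x) (hv : ContinuousOn v S)
    (hw : ∀ x ∈ S, IsEvolution β (f x) (B fun _ ↦ v x) (ι (w x))) : ContinuousOn w S := by
  intro x₀ hx₀
  have hε : 0 < f x₀ / 2 := half_pos (hf0 x₀ hx₀)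
  -- Half of the smoothing time at `x₀` is spent on a fixed bounded multilinear map; the remaining,
  -- varying time is left to the norm continuous evolution.
  set G := smoothingMap h.injective hβ hB hε with hG
  have hc : ContinuousWithinAt
      (fun x ↦ evolutionCLM h β (f x - f x₀ / 2) (G fun _ ↦ v x)) S x₀ := by
    have h1 : ContinuousAt (evolutionCLM h β) (f x₀ - f x₀ / 2) :=
      (continuousOn_evolutionCLM h hβ).continuousAt (Ioi_mem_nhds (by linarith))
    have h2 : ContinuousWithinAt (fun x ↦ evolutionCLM h β (f x - f x₀ / 2)) S x₀ :=
      h1.comp_continuousWithinAt (f := fun x ↦ f x - f x₀ / 2)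
        ((hf x₀ hx₀).sub continuousWithinAt_const)
    refine h2.clm_apply (G.cont.continuousAt.comp_continuousWithinAt ?_)
    exact continuousWithinAt_pi.2 fun _ ↦ hv x₀ hx₀
  have hev : ∀ᶠ x in 𝓝[S] x₀, f x₀ / 2 < f x :=
    (hf x₀ hx₀).eventually (eventually_gt_nhds (by linarith))
  have key : ∀ x ∈ S, f x₀ / 2 < f x →
      w x = evolutionCLM h β (f x - f x₀ / 2) (G fun _ ↦ v x) := by
    intro x hx hfx
    refine ((isEvolution_smoothingMap h.injective hβ hB hε fun _ ↦ v x).evolutionCLM_eq h hβ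
      (by linarith) hε ?_).symm
    rw [sub_add_cancel]
    exact hw x hx
  refine hc.congr_of_eventuallyEq ?_ (key x₀ hx₀ (by linarith))
  filter_upwards [hev, self_mem_nhdsWithin] with x hx hxS using key x hxS hx

/-- For a continuous path `v`, Duhamel's formula defines a continuous path. -/
lemma exists_isDuhamel (h : IsTranslationInvariantSpace ι) (hβ : 0 < β)
    (hαγ : α < γ) (hγ : γ < β) (hκ : m * α' = α + β - γ) (hC : 0 ≤ C)
    (hB : SmoothingBound β ι B fun t ↦ C * t ^ (-γ / β)) {u₀ : Tempered 𝕜 n}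
    (hu₀ : beNorm β α ι u₀ ≠ ∞) {v : ℝ → F} {M : ℝ} (hvc : ContinuousOn v (Ioi 0))
    (hv : ∀ t, 0 < t → ‖v t‖ ≤ M * t ^ (-α' / β)) :
    ∃ u : ℝ → E, IsDuhamel β ι u₀ (fun τ ↦ B fun _ ↦ v τ) u ∧ ContinuousOn u (Ioi 0) := by
  have hM0 : 0 ≤ M := by simpa using (norm_nonneg _).trans (hv 1 one_pos)
  have e1 : -1 < -γ / β := by rw [lt_div_iff₀ hβ]; linarith
  have e3 : -1 < -(m * α') / β := by rw [lt_div_iff₀ hβ]; linarith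
  have hex : ∀ t, 0 < t → ∃ x : E, IsEvolution β t u₀ (ι x) :=
    fun t ht ↦ exists_isEvolution_of_beNorm_ne_top hu₀ ht
  choose! x hx using hex
  have hgex : ∀ t τ, τ ∈ Ioo 0 t → ∃ w : E, IsEvolution β (t - τ) (B fun _ ↦ v τ) (ι w) ∧
      ‖w‖ ≤ C * M ^ m * ((t - τ) ^ (-γ / β) * τ ^ (-(m * α') / β)) := by
    intro t τ hτ
    have ht' : 0 < t - τ := sub_pos.2 hτ.2
    obtain ⟨w, hw, hwn⟩ := hB (t - τ) ht' fun _ ↦ v τ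
    refine ⟨w, hw, hwn.trans ?_⟩
    rw [Finset.prod_const, Finset.card_fin]
    have h1 : τ ^ (-(m * α') / β) = (τ ^ (-α' / β)) ^ m := by
      rw [← Real.rpow_natCast, ← Real.rpow_mul hτ.1.le]
      congr 1; ring
    have h2 : ‖v τ‖ ^ m ≤ (M * τ ^ (-α' / β)) ^ m := by gcongr; exact hv τ hτ.1
    rw [mul_pow, ← h1] at h2
    calc C * (t - τ) ^ (-γ / β) * ‖v τ‖ ^ m
        ≤ C * (t - τ) ^ (-γ / β) * (M ^ m * τ ^ (-(m * α') / β)) := by gcongr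
      _ = _ := by ring
  choose! g hg hgn using hgex
  have hgc : ∀ t, 0 < t → ContinuousOn (g t) (Ioo 0 t) := fun t _ ↦
    continuousOn_of_isEvolution_form h hβ hB (f := fun τ ↦ t - τ) (v := v)
      (continuousOn_const.sub continuousOn_id) (fun τ hτ ↦ sub_pos.2 hτ.2)
      (hvc.mono fun τ hτ ↦ hτ.1) (fun τ hτ ↦ hg t τ hτ)
  have hgi : ∀ t, 0 < t → IntegrableOn (g t) (Ioo 0 t) := fun t ht ↦
    ((integrableOn_sub_rpow_mul_rpow e1 e3 ht).const_mul (C * M ^ m)).mono'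
      ((hgc t ht).aestronglyMeasurable measurableSet_Ioo)
      ((ae_restrict_iff' measurableSet_Ioo).2 (.of_forall (hgn t)))
  refine ⟨fun t ↦ x t + ∫ τ in Ioo 0 t, g t τ,
    fun t ht ↦ ⟨x t, g t, hx t ht, hg t, hgi t ht, rfl⟩, ?_⟩
  refine (continuousOn_of_isEvolution h hβ hx).add ?_
  -- The substitution `τ = t s` fixes the domain of integration, so continuity in `t` follows by
  -- dominated convergence.
  have hsub : ∀ t ∈ Ioi (0 : ℝ), ∫ τ in Ioo 0 t, g t τ =
      ∫ s in Ioo (0 : ℝ) 1, t • g t (t * s) := fun t ht ↦ setIntegral_Ioo_eq_smul _ ht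
  refine ContinuousOn.congr ?_ hsub
  have hmem : ∀ t, 0 < t → ∀ s ∈ Ioo (0 : ℝ) 1, t * s ∈ Ioo 0 t := fun t ht s hs ↦
    ⟨mul_pos ht hs.1, by nlinarith [hs.2]⟩
  intro t₀ ht₀
  rw [mem_Ioi] at ht₀
  refine ContinuousAt.continuousWithinAt ?_
  set e : ℝ := -γ / β + -(m * α') / β with he
  have hpow : ContinuousAt (fun t : ℝ ↦ t * t ^ e) t₀ :=
    continuousAt_id.mul (Real.continuousAt_rpow_const _ _ (Or.inl ht₀.ne'))
  have hev : ∀ᶠ t in 𝓝 t₀, 0 < t ∧ t * t ^ e ≤ t₀ * t₀ ^ e + 1 :=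
    (eventually_gt_nhds ht₀).and (hpow.eventually (eventually_le_nhds (by linarith)))
  refine continuousAt_of_dominated (bound := fun s ↦ (t₀ * t₀ ^ e + 1) *
    (C * M ^ m * ((1 - s) ^ (-γ / β) * s ^ (-(m * α') / β)))) ?_ ?_ ?_ ?_
  · filter_upwards [hev] with t ht
    refine ContinuousOn.aestronglyMeasurable ?_ measurableSet_Ioo
    exact ((hgc t ht.1).comp (continuousOn_const.mul continuousOn_id)
      (hmem t ht.1)).const_smul t
  · filter_upwards [hev] with t ht
    refine (ae_restrict_iff' measurableSet_Ioo).2 (.of_forall fun s hs ↦ ?_)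
    have h1 := hgn t (t * s) (hmem t ht.1 s hs)
    rw [sub_rpow_mul_rpow_eq ht.1 hs] at h1
    have h2 : 0 ≤ (1 - s) ^ (-γ / β) * s ^ (-(m * α') / β) :=
      mul_nonneg (Real.rpow_nonneg (by linarith [hs.2]) _) (Real.rpow_nonneg hs.1.le _)
    rw [norm_smul, Real.norm_of_nonneg ht.1.le]
    calc t * ‖g t (t * s)‖
        ≤ t * (C * M ^ m * (t ^ e * ((1 - s) ^ (-γ / β) * s ^ (-(m * α') / β)))) := by
          have := ht.1.le
          gcongr
      _ = t * t ^ e * (C * M ^ m * ((1 - s) ^ (-γ / β) * s ^ (-(m * α') / β))) := by ring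
      _ ≤ _ := by
          gcongr
          exact ht.2
  · have h1 := intervalIntegrable_one_sub_rpow_mul_rpow e1 e3
    rw [intervalIntegrable_iff_integrableOn_Ioo_of_le zero_le_one] at h1
    exact (h1.const_mul _).const_mul _
  · refine (ae_restrict_iff' measurableSet_Ioo).2 (.of_forall fun s hs ↦ ?_)
    refine continuousAt_id.smul ?_
    have hs' : 0 < 1 - s := by linarith [hs.2]
    -- For fixed `s` both the smoothing time `t - t s` and the argument `v (t s)` move with `t`.
    have h1 : ContinuousOn (fun t ↦ g t (t * s)) (Ioi 0) := by
      refine continuousOn_of_isEvolution_form h hβ hB (f := fun t ↦ t - t * s)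
        (v := fun t ↦ v (t * s)) (by fun_prop) (fun t ht ↦ ?_) ?_ fun t ht ↦ ?_
      · exact sub_pos.2 (hmem t ht s hs).2
      · exact hvc.comp (by fun_prop) fun t ht ↦ (hmem t ht s hs).1
      · exact hg t (t * s) (hmem t ht s hs)
    exact h1.continuousAt (Ioi_mem_nhds ht₀)

end Existence

/-! ### Weighted continuous paths as a Banach space -/

section WeightedPath

open BoundedContinuousFunction

variable {E : Type*} [NormedAddCommGroup E] [NormedSpace ℝ E] {β α : ℝ}

/-- The path `t ↦ t^{-α/β} z(t)` on `(0, ∞)`, extended by zero. -/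
def weightedPath (β α : ℝ) (z : Ioi (0 : ℝ) →ᵇ E) (t : ℝ) : E :=
  if ht : 0 < t then t ^ (-α / β) • z ⟨t, ht⟩ else 0

lemma weightedPath_of_pos (z : Ioi (0 : ℝ) →ᵇ E) {t : ℝ} (ht : 0 < t) :
    weightedPath β α z t = t ^ (-α / β) • z ⟨t, ht⟩ :=
  dif_pos ht

lemma weightedPath_sub (z w : Ioi (0 : ℝ) →ᵇ E) {t : ℝ} (ht : 0 < t) :
    weightedPath β α (z - w) t = weightedPath β α z t - weightedPath β α w t := by
  simp only [weightedPath_of_pos _ ht, BoundedContinuousFunction.sub_apply, smul_sub]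

lemma norm_weightedPath_le {z : Ioi (0 : ℝ) →ᵇ E} {M : ℝ} (hz : ‖z‖ ≤ M) {t : ℝ} (ht : 0 < t) :
    ‖weightedPath β α z t‖ ≤ M * t ^ (-α / β) := by
  rw [weightedPath_of_pos _ ht, norm_smul, Real.norm_of_nonneg (by positivity), mul_comm]
  gcongr
  exact (z.norm_coe_le_norm _).trans hz

lemma norm_le_of_weightedPath_le {z : Ioi (0 : ℝ) →ᵇ E} {M : ℝ} (hM : 0 ≤ M)
    (h : ∀ t, 0 < t → ‖weightedPath β α z t‖ ≤ M * t ^ (-α / β)) : ‖z‖ ≤ M := by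
  refine (BoundedContinuousFunction.norm_le hM).2 fun ⟨t, ht⟩ ↦ ?_
  have h1 := h t ht
  have h2 : 0 < t ^ (-α / β) := Real.rpow_pos_of_pos ht _
  rw [weightedPath_of_pos _ ht, norm_smul, Real.norm_of_nonneg h2.le, mul_comm] at h1
  exact le_of_mul_le_mul_right h1 h2

lemma continuousOn_weightedPath (z : Ioi (0 : ℝ) →ᵇ E) :
    ContinuousOn (weightedPath β α z) (Ioi 0) := by
  rw [continuousOn_iff_continuous_domRestrict]
  have : (Ioi (0 : ℝ)).domRestrict (weightedPath β α z) =
      fun t : Ioi (0 : ℝ) ↦ (t : ℝ) ^ (-α / β) • z t := by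
    ext1 t
    exact weightedPath_of_pos z t.2
  rw [this]
  exact (continuous_subtype_val.rpow_const fun t ↦ Or.inl (ne_of_gt t.2)).smul z.continuous

lemma exists_weightedPath_eq {u : ℝ → E} (hu : ContinuousOn u (Ioi 0)) {M : ℝ}
    (h : ∀ t, 0 < t → ‖u t‖ ≤ M * t ^ (-α / β)) :
    ∃ z : Ioi (0 : ℝ) →ᵇ E, ∀ t, 0 < t → weightedPath β α z t = u t := by
  have hc : Continuous fun t : Ioi (0 : ℝ) ↦ (t : ℝ) ^ (α / β) • u t :=
    (continuous_subtype_val.rpow_const fun t ↦ Or.inl (ne_of_gt t.2)).smul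
      (continuousOn_iff_continuous_domRestrict.1 hu)
  have hinv : ∀ t : ℝ, 0 < t → t ^ (-α / β) * t ^ (α / β) = 1 := fun t ht ↦ by
    rw [← Real.rpow_add ht, neg_div, neg_add_cancel, Real.rpow_zero]
  refine ⟨BoundedContinuousFunction.ofNormedAddCommGroup _ hc M fun ⟨t, ht⟩ ↦ ?_, fun t ht ↦ ?_⟩
  · rw [mem_Ioi] at ht
    rw [norm_smul, Real.norm_of_nonneg (by positivity)]
    calc t ^ (α / β) * ‖u t‖ ≤ t ^ (α / β) * (M * t ^ (-α / β)) := by gcongr; exact h t ht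
      _ = M * (t ^ (-α / β) * t ^ (α / β)) := by ring
      _ = M := by rw [hinv t ht, mul_one]
  · rw [weightedPath_of_pos _ ht]
    simp [smul_smul, hinv t ht]

end WeightedPath

/-! ### One equation of the system -/

section Equation

variable {𝕜 : Type*} [RCLike 𝕜] {n : ℕ} {E F : Type*} [NormedAddCommGroup E]
  [NormedSpace 𝕜 E] [NormedAddCommGroup F] [NormedSpace 𝕜 F]

/-- The hypotheses on one equation of the system: the form `B` satisfies a power-like smoothing
bound whose exponents are subcritical for the weights `α` and `α'` in `E` and `F`. -/
structure IsSubcritical {m : ℕ} (β α α' γ C : ℝ) (ι : E →L[𝕜] Tempered 𝕜 n)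
    (B : MultilinearMap 𝕜 (fun _ : Fin m ↦ F) (Tempered 𝕜 n)) : Prop where
  space : IsTranslationInvariantSpace ι
  order_pos : 0 < β
  weight_pos : 0 < α
  weight_lt : α < γ
  lt_order : γ < β
  arity_ne_zero : m ≠ 0
  balance : m * α' = α + β - γ
  const_nonneg : 0 ≤ C
  bound : SmoothingBound β ι B fun t ↦ C * t ^ (-γ / β)

variable {ι : E →L[𝕜] Tempered 𝕜 n} {β α α' γ C : ℝ} {m : ℕ}
  {B : MultilinearMap 𝕜 (fun _ : Fin m ↦ F) (Tempered 𝕜 n)}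

lemma IsSubcritical.betaConst_nonneg (hB : IsSubcritical β α α' γ C ι B) (κ : ℝ) :
    0 ≤ betaConst β C α γ κ :=
  mul_nonneg hB.const_nonneg (add_nonneg (integral_one_sub_rpow_mul_rpow_nonneg _ _)
    (integral_one_sub_rpow_mul_rpow_nonneg _ _))

variable [NormedSpace ℝ E] {u₀ u₀' : Tempered 𝕜 n}
  {v v' : ℝ → F} {u u' : ℝ → E} {M D : ℝ}

lemma IsDuhamel.congr {h h' : ℝ → Tempered 𝕜 n} (hu : IsDuhamel β ι u₀ h u)
    (hh : ∀ t, 0 < t → h' t = h t) (huu : ∀ t, 0 < t → u' t = u t) :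
    IsDuhamel β ι u₀ h' u' := by
  intro t ht
  obtain ⟨x, g, hx, hg, hgi, hut⟩ := hu t ht
  refine ⟨x, g, hx, fun τ hτ ↦ ?_, hgi, (huu t ht).trans hut⟩
  rw [hh τ hτ.1]
  exact hg τ hτ

/-- A form of positive arity vanishes at zero, so zero solves the equation with zero data; it serves
as the comparison path for a priori bounds. -/
lemma isDuhamel_zero (hm : m ≠ 0) : IsDuhamel β ι 0 (fun τ ↦ B fun _ ↦ (0 : ℝ → F) τ) 0 := by
  have hB : (B fun _ ↦ (0 : F)) = 0 := B.map_coord_zero ⟨0, Nat.pos_of_ne_zero hm⟩ rfl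
  refine fun t _ ↦ ⟨0, 0, ?_, fun τ _ ↦ ?_, integrableOn_zero, by simp⟩
  · rw [map_zero]
    exact isEvolution_zero β t
  · simp only [Pi.zero_apply, map_zero, hB]
    exact isEvolution_zero β (t - τ)

variable [IsScalarTower ℝ 𝕜 E] [CompleteSpace E]

lemma IsSubcritical.pathNorm_sub_le (hB : IsSubcritical β α α' γ C ι B)
    (hu : IsDuhamel β ι u₀ (fun τ ↦ B fun _ ↦ v τ) u)
    (hu' : IsDuhamel β ι u₀' (fun τ ↦ B fun _ ↦ v' τ) u')
    (hv : ∀ t, 0 < t → ‖v t‖ ≤ M * t ^ (-α' / β))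
    (hv' : ∀ t, 0 < t → ‖v' t‖ ≤ M * t ^ (-α' / β))
    (hD : ∀ t, 0 < t → ‖v t - v' t‖ ≤ D * t ^ (-α' / β)) :
    pathNorm β α ι (u - u') ≤ 2 * beNorm β α ι (u₀ - u₀') +
      ENNReal.ofReal (m * M ^ (m - 1) * betaConst β C α γ (m * α') * D) := by
  rw [mul_right_comm]
  exact hu.pathNorm_sub_le hB.space hB.order_pos hB.weight_pos hB.weight_lt hB.lt_order
    hB.arity_ne_zero hB.balance hB.const_nonneg hB.bound hu' hv hv' hD

/-- With equal data the linear parts cancel; this is the contraction estimate. -/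
lemma IsSubcritical.norm_sub_le (hB : IsSubcritical β α α' γ C ι B)
    (hu : IsDuhamel β ι u₀ (fun τ ↦ B fun _ ↦ v τ) u)
    (hu' : IsDuhamel β ι u₀ (fun τ ↦ B fun _ ↦ v' τ) u')
    (hv : ∀ t, 0 < t → ‖v t‖ ≤ M * t ^ (-α' / β))
    (hv' : ∀ t, 0 < t → ‖v' t‖ ≤ M * t ^ (-α' / β)) (hD0 : 0 ≤ D)
    (hD : ∀ t, 0 < t → ‖v t - v' t‖ ≤ D * t ^ (-α' / β)) {t : ℝ} (ht : 0 < t) :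
    ‖u t - u' t‖ ≤ m * M ^ (m - 1) * betaConst β C α γ (m * α') * D * t ^ (-α / β) := by
  have hM0 : 0 ≤ M := by simpa using (norm_nonneg _).trans (hv 1 one_pos)
  have h := hB.pathNorm_sub_le hu hu' hv hv' hD
  rw [sub_self, beNorm_zero, mul_zero, zero_add] at h
  have hK := hB.betaConst_nonneg (m * α')
  exact norm_le_of_pathNorm_le (by positivity) h ht

/-- Comparison with the zero solution, with `D = M`. Using the difference estimate costs a factor
`m`, which is why `q M^q K₁` and `p M^p K₂` stand in the smallness condition. -/
lemma IsSubcritical.pathNorm_le (hB : IsSubcritical β α α' γ C ι B)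
    (hu : IsDuhamel β ι u₀ (fun τ ↦ B fun _ ↦ v τ) u)
    (hv : ∀ t, 0 < t → ‖v t‖ ≤ M * t ^ (-α' / β)) :
    pathNorm β α ι u ≤ 2 * beNorm β α ι u₀ +
      ENNReal.ofReal (m * M ^ m * betaConst β C α γ (m * α')) := by
  have hM0 : 0 ≤ M := by simpa using (norm_nonneg _).trans (hv 1 one_pos)
  have h := hB.pathNorm_sub_le (D := M) hu (isDuhamel_zero hB.arity_ne_zero) hv
    (fun t ht ↦ by rw [Pi.zero_apply, norm_zero]; positivity)
    (fun t ht ↦ by rw [Pi.zero_apply, sub_zero]; exact hv t ht)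
  rw [sub_zero, sub_zero, mul_right_comm, mul_assoc (m : ℝ), ← pow_succ,
    Nat.sub_one_add_one hB.arity_ne_zero] at h
  exact h

end Equation

/-! ### Contraction and continuous dependence for the system -/

section System

open BoundedContinuousFunction

variable {𝕜 : Type*} [RCLike 𝕜] {n : ℕ} {E F : Type*} [NormedAddCommGroup E] [NormedSpace ℝ E]
  [NormedSpace 𝕜 E] [IsScalarTower ℝ 𝕜 E] [CompleteSpace E]
  [NormedAddCommGroup F] [NormedSpace ℝ F] [NormedSpace 𝕜 F] [IsScalarTower ℝ 𝕜 F]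
  [CompleteSpace F] {ιE : E →L[𝕜] Tempered 𝕜 n} {ιF : F →L[𝕜] Tempered 𝕜 n} {p q : ℕ}
  {B₁ : MultilinearMap 𝕜 (fun _ : Fin q ↦ F) (Tempered 𝕜 n)}
  {B₂ : MultilinearMap 𝕜 (fun _ : Fin p ↦ E) (Tempered 𝕜 n)}
  {β α₁ α₂ γ₁ γ₂ C₁ C₂ K₁ K₂ M R : ℝ} {u₀ u₀' v₀ v₀' : Tempered 𝕜 n}

/-- Existence of a small solution, by the contraction principle. -/
lemma exists_isSolution (h₁ : IsSubcritical β α₁ α₂ γ₁ C₁ ιE B₁)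
    (h₂ : IsSubcritical β α₂ α₁ γ₂ C₂ ιF B₂) (hK₁ : K₁ = betaConst β C₁ α₁ γ₁ (q * α₂))
    (hK₂ : K₂ = betaConst β C₂ α₂ γ₂ (p * α₁)) (hM : 0 ≤ M) (hR : 0 ≤ R)
    (hMR : 2 * R + q * M ^ q * K₁ + p * M ^ p * K₂ ≤ M)
    (hθ : q * M ^ (q - 1) * K₁ + p * M ^ (p - 1) * K₂ < 1)
    (hΦ : beNorm β α₁ ιE u₀ + beNorm β α₂ ιF v₀ ≤ ENNReal.ofReal R) :
    ∃ (u : ℝ → E) (v : ℝ → F), IsSolution β ιE ιF B₁ B₂ u₀ v₀ u v ∧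
      pathNorm β α₁ ιE u + pathNorm β α₂ ιF v ≤ ENNReal.ofReal M := by
  have hK₁0 : 0 ≤ K₁ := hK₁ ▸ h₁.betaConst_nonneg _
  have hK₂0 : 0 ≤ K₂ := hK₂ ▸ h₂.betaConst_nonneg _
  have hu₀ : beNorm β α₁ ιE u₀ ≠ ∞ :=
    ((le_self_add.trans hΦ).trans_lt ENNReal.ofReal_lt_top).ne
  have hv₀ : beNorm β α₂ ιF v₀ ≠ ∞ :=
    ((le_add_self.trans hΦ).trans_lt ENNReal.ofReal_lt_top).ne
  -- Used twice: it keeps the iteration in the ball, and at the fixed point it bounds the full path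
  -- norm, whose `BE` part the weighted sup norm does not contain.
  have hself : ∀ (u u' : ℝ → E) (v v' : ℝ → F),
      IsDuhamel β ιE u₀ (fun τ ↦ B₁ fun _ ↦ v τ) u' →
      IsDuhamel β ιF v₀ (fun τ ↦ B₂ fun _ ↦ u τ) v' →
      (∀ t, 0 < t → ‖u t‖ ≤ M * t ^ (-α₁ / β)) → (∀ t, 0 < t → ‖v t‖ ≤ M * t ^ (-α₂ / β)) →
      pathNorm β α₁ ιE u' + pathNorm β α₂ ιF v' ≤ ENNReal.ofReal M := by
    intro u u' v v' hu' hv' hu hv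
    refine (add_le_add (h₁.pathNorm_le hu' hv) (h₂.pathNorm_le hv' hu)).trans ?_
    rw [← hK₁, ← hK₂, add_add_add_comm, ← mul_add]
    calc _ ≤ 2 * ENNReal.ofReal R + (ENNReal.ofReal (q * M ^ q * K₁) +
          ENNReal.ofReal (p * M ^ p * K₂)) := by gcongr
      _ = ENNReal.ofReal (2 * R + (q * M ^ q * K₁ + p * M ^ p * K₂)) := by
          rw [ENNReal.ofReal_add (by positivity) (by positivity),
            ENNReal.ofReal_add (by positivity) (by positivity),
            ENNReal.ofReal_mul zero_le_two, ENNReal.ofReal_ofNat]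
      _ ≤ _ := ENNReal.ofReal_le_ofReal (by linarith)
  set s : Set ((Ioi (0 : ℝ) →ᵇ E) × (Ioi (0 : ℝ) →ᵇ F)) := Metric.closedBall 0 M with hs
  have hs_iff : ∀ z, z ∈ s ↔ ‖z.1‖ ≤ M ∧ ‖z.2‖ ≤ M := fun z ↦ by
    rw [hs, mem_closedBall_zero_iff, Prod.norm_def, max_le_iff]
  have hex : ∀ z ∈ s, ∃ z' ∈ s,
      IsDuhamel β ιE u₀ (fun τ ↦ B₁ fun _ ↦ weightedPath β α₂ z.2 τ) (weightedPath β α₁ z'.1) ∧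
      IsDuhamel β ιF v₀ (fun τ ↦ B₂ fun _ ↦ weightedPath β α₁ z.1 τ) (weightedPath β α₂ z'.2) := by
    intro z hz
    rw [hs_iff] at hz
    have hz1 : ∀ t, 0 < t → ‖weightedPath β α₁ z.1 t‖ ≤ M * t ^ (-α₁ / β) :=
      fun t ht ↦ norm_weightedPath_le hz.1 ht
    have hz2 : ∀ t, 0 < t → ‖weightedPath β α₂ z.2 t‖ ≤ M * t ^ (-α₂ / β) :=
      fun t ht ↦ norm_weightedPath_le hz.2 ht
    obtain ⟨u, hu, huc⟩ := exists_isDuhamel h₁.space h₁.order_pos h₁.weight_lt h₁.lt_order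
      h₁.balance h₁.const_nonneg h₁.bound hu₀ (continuousOn_weightedPath z.2) hz2
    obtain ⟨v, hv, hvc⟩ := exists_isDuhamel h₂.space h₂.order_pos h₂.weight_lt h₂.lt_order
      h₂.balance h₂.const_nonneg h₂.bound hv₀ (continuousOn_weightedPath z.1) hz1
    have hUV := hself _ u _ v hu hv hz1 hz2
    have hub : ∀ t, 0 < t → ‖u t‖ ≤ M * t ^ (-α₁ / β) :=
      fun t ht ↦ norm_le_of_pathNorm_le hM (le_self_add.trans hUV) ht
    have hvb : ∀ t, 0 < t → ‖v t‖ ≤ M * t ^ (-α₂ / β) :=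
      fun t ht ↦ norm_le_of_pathNorm_le hM (le_add_self.trans hUV) ht
    obtain ⟨z₁, hz₁⟩ := exists_weightedPath_eq huc hub
    obtain ⟨z₂, hz₂⟩ := exists_weightedPath_eq hvc hvb
    refine ⟨(z₁, z₂), (hs_iff _).2 ⟨?_, ?_⟩, hu.congr (fun _ _ ↦ rfl) hz₁,
      hv.congr (fun _ _ ↦ rfl) hz₂⟩
    · exact norm_le_of_weightedPath_le hM fun t ht ↦ (hz₁ t ht).symm ▸ hub t ht
    · exact norm_le_of_weightedPath_le hM fun t ht ↦ (hz₂ t ht).symm ▸ hvb t ht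
  choose! f hfs hf using hex
  set θ : ℝ := q * M ^ (q - 1) * K₁ + p * M ^ (p - 1) * K₂ with hθ_def
  have hθ₁ : 0 ≤ q * M ^ (q - 1) * K₁ := by positivity
  have hθ₂ : 0 ≤ p * M ^ (p - 1) * K₂ := by positivity
  have hcontr : ∀ z ∈ s, ∀ w ∈ s, dist (f z) (f w) ≤ θ * dist z w := by
    intro z hz w hw
    have hz' := (hs_iff z).1 hz
    have hw' := (hs_iff w).1 hw
    have hD₁ : ‖z.1 - w.1‖ ≤ dist z w := by
      rw [dist_eq_norm]; exact norm_fst_le (z - w)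
    have hD₂ : ‖z.2 - w.2‖ ≤ dist z w := by
      rw [dist_eq_norm]; exact norm_snd_le (z - w)
    rw [dist_eq_norm (f z), Prod.norm_def, max_le_iff]
    constructor
    · refine norm_le_of_weightedPath_le (β := β) (α := α₁) (by positivity) fun t ht ↦ ?_
      rw [Prod.fst_sub, weightedPath_sub _ _ ht]
      refine (h₁.norm_sub_le (D := dist z w) (hf z hz).1 (hf w hw).1
        (fun t ht ↦ norm_weightedPath_le hz'.2 ht)
        (fun t ht ↦ norm_weightedPath_le hw'.2 ht) dist_nonneg (fun t ht ↦ ?_) ht).trans ?_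
      · rw [← weightedPath_sub _ _ ht]
        exact norm_weightedPath_le hD₂ ht
      · rw [← hK₁]
        gcongr
        linarith
    · refine norm_le_of_weightedPath_le (β := β) (α := α₂) (by positivity) fun t ht ↦ ?_
      rw [Prod.snd_sub, weightedPath_sub _ _ ht]
      refine (h₂.norm_sub_le (D := dist z w) (hf z hz).2 (hf w hw).2
        (fun t ht ↦ norm_weightedPath_le hz'.1 ht)
        (fun t ht ↦ norm_weightedPath_le hw'.1 ht) dist_nonneg (fun t ht ↦ ?_) ht).trans ?_
      · rw [← weightedPath_sub _ _ ht]
        exact norm_weightedPath_le hD₁ ht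
      · rw [← hK₂]
        gcongr
        linarith
  have hmaps : MapsTo f s s := hfs
  have hcontracting : ContractingWith θ.toNNReal (hmaps.restrict f s s) := by
    refine ⟨by simpa using hθ, LipschitzWith.of_dist_le_mul fun z w ↦ ?_⟩
    rw [Real.coe_toNNReal _ (by positivity)]
    exact hcontr z z.2 w w.2
  have hcomplete : IsComplete s := Metric.isClosed_closedBall.isComplete
  obtain ⟨z, hz, hfz, -⟩ := hcontracting.exists_fixedPoint' hcomplete hmaps
    (Metric.mem_closedBall_self hM) (edist_ne_top _ _)
  have hsol := hf z hz
  rw [hfz] at hsol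
  have hz' := (hs_iff z).1 hz
  exact ⟨_, _, hsol, hself _ _ _ _ hsol.1 hsol.2 (fun t ht ↦ norm_weightedPath_le hz'.1 ht)
    fun t ht ↦ norm_weightedPath_le hz'.2 ht⟩

/-- Small solutions depend continuously on the data. -/
lemma IsSolution.pathNorm_sub_le (h₁ : IsSubcritical β α₁ α₂ γ₁ C₁ ιE B₁)
    (h₂ : IsSubcritical β α₂ α₁ γ₂ C₂ ιF B₂) (hK₁ : K₁ = betaConst β C₁ α₁ γ₁ (q * α₂))
    (hK₂ : K₂ = betaConst β C₂ α₂ γ₂ (p * α₁)) (hM : 0 ≤ M)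
    (hθ : q * M ^ (q - 1) * K₁ + p * M ^ (p - 1) * K₂ < 1) {u u' : ℝ → E} {v v' : ℝ → F}
    (hU : IsSolution β ιE ιF B₁ B₂ u₀ v₀ u v) (hU' : IsSolution β ιE ιF B₁ B₂ u₀' v₀' u' v')
    (hUM : pathNorm β α₁ ιE u + pathNorm β α₂ ιF v ≤ ENNReal.ofReal M)
    (hUM' : pathNorm β α₁ ιE u' + pathNorm β α₂ ιF v' ≤ ENNReal.ofReal M) :
    pathNorm β α₁ ιE (u - u') + pathNorm β α₂ ιF (v - v') ≤
      ENNReal.ofReal (2 * (1 - (q * M ^ (q - 1) * K₁ + p * M ^ (p - 1) * K₂))⁻¹) *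
        (beNorm β α₁ ιE (u₀ - u₀') + beNorm β α₂ ιF (v₀ - v₀')) := by
  have hK₁0 : 0 ≤ K₁ := hK₁ ▸ h₁.betaConst_nonneg _
  have hK₂0 : 0 ≤ K₂ := hK₂ ▸ h₂.betaConst_nonneg _
  have hθ₁ : 0 ≤ q * M ^ (q - 1) * K₁ := by positivity
  have hθ₂ : 0 ≤ p * M ^ (p - 1) * K₂ := by positivity
  set θ : ℝ := q * M ^ (q - 1) * K₁ + p * M ^ (p - 1) * K₂ with hθ_def
  have hu : ∀ t, 0 < t → ‖u t‖ ≤ M * t ^ (-α₁ / β) :=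
    fun t ht ↦ norm_le_of_pathNorm_le hM (le_self_add.trans hUM) ht
  have hu' : ∀ t, 0 < t → ‖u' t‖ ≤ M * t ^ (-α₁ / β) :=
    fun t ht ↦ norm_le_of_pathNorm_le hM (le_self_add.trans hUM') ht
  have hv : ∀ t, 0 < t → ‖v t‖ ≤ M * t ^ (-α₂ / β) :=
    fun t ht ↦ norm_le_of_pathNorm_le hM (le_add_self.trans hUM) ht
  have hv' : ∀ t, 0 < t → ‖v' t‖ ≤ M * t ^ (-α₂ / β) :=
    fun t ht ↦ norm_le_of_pathNorm_le hM (le_add_self.trans hUM') ht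
  set b := beNorm β α₁ ιE (u₀ - u₀') + beNorm β α₂ ιF (v₀ - v₀') with hb_def
  have hpos : 0 < 2 * (1 - θ)⁻¹ := mul_pos two_pos (inv_pos.2 (sub_pos.2 hθ))
  rcases eq_or_ne b ∞ with hb | hb
  · rw [hb, ENNReal.mul_top (by simpa using hpos)]
    exact le_top
  have hb' := ENNReal.add_ne_top.1 hb
  have hfin : ∀ x : ℝ≥0∞, x ≠ ∞ → ∀ y : ℝ, 2 * x + ENNReal.ofReal y ≠ ∞ := fun x hx y ↦
    ENNReal.add_ne_top.2 ⟨ENNReal.mul_ne_top (by simp) hx, ENNReal.ofReal_ne_top⟩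
  have h2M : ∀ {r x y : ℝ}, x ≤ M * r → y ≤ M * r → x + y ≤ 2 * M * r := fun h h' ↦ by linarith
  -- A priori finiteness, from the crude choice `D = 2M`; without it the differences could not be
  -- absorbed below.
  have hPfin : pathNorm β α₁ ιE (u - u') ≠ ∞ := ne_top_of_le_ne_top (hfin _ hb'.1 _)
    (h₁.pathNorm_sub_le hU.1 hU'.1 hv hv' fun t ht ↦
      (norm_sub_le _ _).trans (h2M (hv t ht) (hv' t ht)))
  have hQfin : pathNorm β α₂ ιF (v - v') ≠ ∞ := ne_top_of_le_ne_top (hfin _ hb'.2 _)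
    (h₂.pathNorm_sub_le hU.2 hU'.2 hu hu' fun t ht ↦
      (norm_sub_le _ _).trans (h2M (hu t ht) (hu' t ht)))
  set P := (pathNorm β α₁ ιE (u - u')).toReal with hP
  set Q := (pathNorm β α₂ ιF (v - v')).toReal with hQ
  have hPeq : ENNReal.ofReal P = pathNorm β α₁ ιE (u - u') := ENNReal.ofReal_toReal hPfin
  have hQeq : ENNReal.ofReal Q = pathNorm β α₂ ιF (v - v') := ENNReal.ofReal_toReal hQfin
  have hP0 : 0 ≤ P := ENNReal.toReal_nonneg
  have hQ0 : 0 ≤ Q := ENNReal.toReal_nonneg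
  -- The equations are crossed: the difference in `u` is controlled by `Q`, that in `v` by `P`.
  have e₁ := h₁.pathNorm_sub_le hU.1 hU'.1 hv hv' (D := Q) fun t ht ↦
    norm_le_of_pathNorm_le (u := v - v') hQ0 hQeq.ge ht
  have e₂ := h₂.pathNorm_sub_le hU.2 hU'.2 hu hu' (D := P) fun t ht ↦
    norm_le_of_pathNorm_le (u := u - u') hP0 hPeq.ge ht
  have e := add_le_add e₁ e₂
  rw [← hK₁, ← hK₂, add_add_add_comm, ← mul_add, ← hb_def, ← hPeq, ← hQeq,
    ← ENNReal.ofReal_toReal hb, ← ENNReal.ofReal_add hP0 hQ0, ← ENNReal.ofReal_add (by positivity)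
    (by positivity), ← ENNReal.ofReal_ofNat, ← ENNReal.ofReal_mul (by positivity),
    ← ENNReal.ofReal_add (by positivity) (by positivity),
    ENNReal.ofReal_le_ofReal_iff (by positivity)] at e
  rw [← hPeq, ← hQeq, ← ENNReal.ofReal_toReal hb, ← ENNReal.ofReal_add hP0 hQ0,
    ← ENNReal.ofReal_mul hpos.le]
  refine ENNReal.ofReal_le_ofReal ?_
  have h1θ : 0 < 1 - θ := sub_pos.2 hθ
  rw [mul_right_comm, ← div_eq_mul_inv, le_div_iff₀ h1θ]
  -- With `b` the distance of the data, `P + Q ≤ 2b + θ₁ Q + θ₂ P ≤ 2b + θ (P + Q)`; the last term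
  -- is absorbed since `θ < 1`.
  nlinarith [mul_nonneg hθ₁ hP0, mul_nonneg hθ₂ hQ0]

end System

end FracSystem

end

/-! ### The main theorem -/

open FracSystem in
theorem theorem1p5 {𝕜 : Type*} [RCLike 𝕜] {n : ℕ} (hn : 1 ≤ n)
    {E F : Type*} [NormedAddCommGroup E] [NormedSpace ℝ E] [NormedSpace 𝕜 E] [IsScalarTower ℝ 𝕜 E]
    [CompleteSpace E]
    [NormedAddCommGroup F] [NormedSpace ℝ F] [NormedSpace 𝕜 F] [IsScalarTower ℝ 𝕜 F]
    [CompleteSpace F]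
    (ιE : E →L[𝕜] Tempered 𝕜 n) (ιF : F →L[𝕜] Tempered 𝕜 n)
    {β : ℝ} (hβ : 0 < β) {p q : ℕ} (hpq : 1 < p * q)
    (B₁ : MultilinearMap 𝕜 (fun _ : Fin q ↦ F) (Tempered 𝕜 n))
    (B₂ : MultilinearMap 𝕜 (fun _ : Fin p ↦ E) (Tempered 𝕜 n))
    {a b σ₁ σ₂ α₁ α₂ : ℝ}
    (hE : InClassX β ιE) (hF : InClassX β ιF)
    (ha : HasScalingDegree ιE a) (hb : HasScalingDegree ιF b)
    (hσ₁ : FormHasScalingDegree ιF B₁ σ₁) (hσ₂ : FormHasScalingDegree ιE B₂ σ₂)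
    (had : IsAdequate β ιE ιF B₁ B₂)
    (hα₁ : α₁ = β * (1 + q) / (p * q - 1) + a - (σ₁ + q * σ₂) / (p * q - 1))
    (hα₂ : α₂ = β * (1 + p) / (p * q - 1) + b - (σ₂ + p * σ₁) / (p * q - 1))
    (hα₁_pos : 0 < α₁) (hα₂_pos : 0 < α₂)
    (h₁ : α₁ + q * b < a + σ₁) (h₂ : α₂ + p * a < b + σ₂)
    (h₃ : α₁ < q * α₂) (h₄ : α₂ < p * α₁) :
    (∃ C₁ : ℝ, 0 < C₁ ∧ SmoothingBound β ιE B₁ fun t ↦ C₁ * t ^ ((q * b - a - σ₁) / β)) ∧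
    (∃ C₂ : ℝ, 0 < C₂ ∧ SmoothingBound β ιF B₂ fun t ↦ C₂ * t ^ ((p * a - b - σ₂) / β)) ∧
    ∀ C₁ C₂ : ℝ, 0 < C₁ → 0 < C₂ →
      SmoothingBound β ιE B₁ (fun t ↦ C₁ * t ^ ((q * b - a - σ₁) / β)) →
      SmoothingBound β ιF B₂ (fun t ↦ C₂ * t ^ ((p * a - b - σ₂) / β)) →
      ∀ K₁ K₂ : ℝ, K₁ = betaConst β C₁ α₁ (a + σ₁ - q * b) (q * α₂) →
        K₂ = betaConst β C₂ α₂ (b + σ₂ - p * a) (p * α₁) →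
      ∀ M R : ℝ, 0 < M → 0 < R → 2 * R + q * M ^ q * K₁ + p * M ^ p * K₂ < M →
        (∀ u₀ v₀ : Tempered 𝕜 n,
          beNorm β α₁ ιE u₀ + beNorm β α₂ ιF v₀ ≤ ENNReal.ofReal R →
          ∃ (u : ℝ → E) (v : ℝ → F), IsSolution β ιE ιF B₁ B₂ u₀ v₀ u v ∧
            pathNorm β α₁ ιE u + pathNorm β α₂ ιF v ≤ ENNReal.ofReal M ∧
            ∀ (u' : ℝ → E) (v' : ℝ → F), IsSolution β ιE ιF B₁ B₂ u₀ v₀ u' v' →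
              pathNorm β α₁ ιE u' + pathNorm β α₂ ιF v' ≤ ENNReal.ofReal M →
              ∀ t : ℝ, 0 < t → u' t = u t ∧ v' t = v t) ∧
        (∀ (u₀ v₀ u₀' v₀' : Tempered 𝕜 n) (u u' : ℝ → E) (v v' : ℝ → F),
          beNorm β α₁ ιE u₀ + beNorm β α₂ ιF v₀ ≤ ENNReal.ofReal R →
          beNorm β α₁ ιE u₀' + beNorm β α₂ ιF v₀' ≤ ENNReal.ofReal R →
          IsSolution β ιE ιF B₁ B₂ u₀ v₀ u v → IsSolution β ιE ιF B₁ B₂ u₀' v₀' u' v' →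
          pathNorm β α₁ ιE u + pathNorm β α₂ ιF v ≤ ENNReal.ofReal M →
          pathNorm β α₁ ιE u' + pathNorm β α₂ ιF v' ≤ ENNReal.ofReal M →
          pathNorm β α₁ ιE (u - u') + pathNorm β α₂ ιF (v - v') ≤
            ENNReal.ofReal (2 * (1 - (q * M ^ (q - 1) * K₁ + p * M ^ (p - 1) * K₂))⁻¹) *
              (beNorm β α₁ ιE (u₀ - u₀') + beNorm β α₂ ιF (v₀ - v₀'))) := by
  have hp : p ≠ 0 := by rintro rfl; simp at hpq
  have hq : q ≠ 0 := by rintro rfl; simp at hpq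
  have hpq' : (p * q - 1 : ℝ) ≠ 0 := by
    have : (1 : ℝ) < p * q := by exact_mod_cast hpq
    linarith
  have hκ₁ : q * α₂ = α₁ + β - (a + σ₁ - q * b) := by
    rw [hα₁, hα₂]
    generalize hd : (p * q - 1 : ℝ) = d at hpq' ⊢
    field_simp
    linear_combination (β - σ₁) * hd
  have hκ₂ : p * α₁ = α₂ + β - (b + σ₂ - p * a) := by
    rw [hα₁, hα₂]
    generalize hd : (p * q - 1 : ℝ) = d at hpq' ⊢
    field_simp
    linear_combination (β - σ₂) * hd
  have e₁ : ∀ t : ℝ, t ^ ((q * b - a - σ₁) / β) = t ^ (-(a + σ₁ - q * b) / β) := fun t ↦ by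
    congr 2; ring
  have e₂ : ∀ t : ℝ, t ^ ((p * a - b - σ₂) / β) = t ^ (-(b + σ₂ - p * a) / β) := fun t ↦ by
    congr 2; ring
  obtain ⟨ω₁, hω₁, -, hB₁⟩ := had.bound₁
  obtain ⟨ω₂, hω₂, -, hB₂⟩ := had.bound₂
  refine ⟨exists_smoothingBound hβ ha hb hσ₁ (hω₁ 1 one_pos) hB₁,
    exists_smoothingBound hβ hb ha hσ₂ (hω₂ 1 one_pos) hB₂, ?_⟩
  intro C₁ C₂ hC₁ hC₂ hS₁ hS₂ K₁ K₂ hK₁ hK₂ M R hM hR hMR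
  simp only [e₁] at hS₁
  simp only [e₂] at hS₂
  -- The balance identity turns `α₁ < q α₂` into `a + σ₁ - q b < β`.
  have s₁ : IsSubcritical β α₁ α₂ (a + σ₁ - q * b) C₁ ιE B₁ :=
    ⟨had.left, hβ, hα₁_pos, by linarith, by linarith, hq, hκ₁, hC₁.le, hS₁⟩
  have s₂ : IsSubcritical β α₂ α₁ (b + σ₂ - p * a) C₂ ιF B₂ :=
    ⟨had.right, hβ, hα₂_pos, by linarith, by linarith, hp, hκ₂, hC₂.le, hS₂⟩
  -- Multiplied by `M` this is the smallness condition without the positive term `2R`.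
  have hθ : q * M ^ (q - 1) * K₁ + p * M ^ (p - 1) * K₂ < 1 := by
    refine lt_of_mul_lt_mul_right ?_ hM.le
    calc (q * M ^ (q - 1) * K₁ + p * M ^ (p - 1) * K₂) * M
        = q * (M ^ (q - 1) * M) * K₁ + p * (M ^ (p - 1) * M) * K₂ := by ring
      _ < 1 * M := by
          rw [pow_sub_one_mul hq, pow_sub_one_mul hp]
          linarith
  refine ⟨fun u₀ v₀ hΦ ↦ ?_, fun u₀ v₀ u₀' v₀' u u' v v' _ _ hU hU' hUM hUM' ↦
    hU.pathNorm_sub_le s₁ s₂ hK₁ hK₂ hM.le hθ hU' hUM hUM'⟩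
  obtain ⟨u, v, hU, hUM⟩ := exists_isSolution s₁ s₂ hK₁ hK₂ hM.le hR.le hMR.le hθ hΦ
  refine ⟨u, v, hU, hUM, fun u' v' hU' hUM' ↦ ?_⟩
  -- Uniqueness is the stability estimate for equal data.
  have h := hU'.pathNorm_sub_le s₁ s₂ hK₁ hK₂ hM.le hθ hU hUM' hUM
  rw [sub_self, sub_self, beNorm_zero, beNorm_zero, add_zero, mul_zero] at h
  intro t ht
  have hu := norm_le_of_pathNorm_le le_rfl ((le_self_add.trans h).trans zero_le) ht
  have hv := norm_le_of_pathNorm_le le_rfl ((le_add_self.trans h).trans zero_le) ht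
  rw [zero_mul, norm_le_zero_iff, Pi.sub_apply, sub_eq_zero] at hu hv
  exact ⟨hu, hv⟩
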